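/- Let $p$ be a prime, $K$ a finite extension of $\mathbb{Q}_p$ with ring of integers $\mathscr{O}_K$, $\pi$ a uniformizer of $\mathscr{O}_K$, $\kappa=\mathscr{O}_K/\pi\mathscr{O}_K$ the residue field, $W(\kappa)$ its ring of Witt vectors (mapping canonically to $\mathscr{O}_K$), and $E(u)\in W(\kappa)[u]$ the minimal polynomial of $\pi$ over $W(\kappa)$. Let $\mathfrak{S}=W(\kappa)[[u]]$, with the endomorphism $\varphi$ that is the Frobenius on $W(\kappa)$ and satisfies $\varphi(u)=u^p$, and let $\mathscr{O}_{\mathscr{E}}$ be the $p$-adic completion of $\mathfrak{S}[1/u]$, with the induced endomorphism $\varphi$. Let $\mathscr{R}$ be a (commutative) finite flat $\mathbb{Z}_p$-algebra, and put $\mathfrak{S}_{\mathscr{R}}=\mathfrak{S}\otimes_{\mathbb{Z}_p}\mathscr{R}$ and $\mathscr{O}_{\mathscr{E},\mathscr{R}}=\mathscr{O}_{\mathscr{E}}\otimes_{\mathbb{Z}_p}\mathscr{R}$, with the endomorphisms $\varphi\otimes 1$. Let $\mathrm{Mod}^{\varphi}_{/\mathfrak{S}_{\mathscr{R}}}$ be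 the category of $\mathfrak{S}_{\mathscr{R}}$-modules $\mathfrak{M}$ with a $(\varphi\otimes 1)$-semilinear endomorphism $\varphi_{\mathfrak{M}}$, such that $\mathfrak{M}$ is finite free over $\mathfrak{S}$ and, for some integer $h\ge 1$, $E(u)^h$ kills the cokernel of the linearization $1\otimes\varphi_{\mathfrak{M}}:\mathfrak{S}\otimes_{\varphi,\mathfrak{S}}\mathfrak{M}\to\mathfrak{M}$ (i.e. Breuil-Kisin modules equipped with an action of $\mathscr{R}$). Let $\mathrm{Mod}^{\varphi}_{/\mathscr{O}_{\mathscr{E},\mathscr{R}}}$ be the category of $\mathscr{O}_{\mathscr{E},\mathscr{R}}$-modules $\mathscr{M}$ with a $(\varphi\otimes 1)$-semilinear endomorphism $\varphi_{\mathscr{M}}$, such that $\mathscr{M}$ is finite free over $\mathscr{O}_{\mathscr{E}}$ and the linearization $1\otimes\varphi_{\mathscr{M}}:\mathscr{O}_{\mathscr{E}}\otimes_{\varphi,\mathscr{O}_{\mathscr{E}}}\mathscr{M}\to\mathscr{M}$ is an isomorphism (i.e. free étale $\varphi$-modules over $\mathscr{O}_{\mathscr{E}}$ equipped with an action of $\mathscr{R}$).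 In both categories the morphisms are the linear maps (over $\mathfrak{S}_{\mathscr{R}}$, resp. $\mathscr{O}_{\mathscr{E},\mathscr{R}}$) that commute with the semilinear endomorphisms. Then the functor $$\mathrm{Mod}^{\varphi}_{/\mathfrak{S}_{\mathscr{R}}}\to\mathrm{Mod}^{\varphi}_{/\mathscr{O}_{\mathscr{E},\mathscr{R}}},\qquad \mathfrak{M}\mapsto\mathfrak{M}\otimes_{\mathfrak{S}_{\mathscr{R}}}\mathscr{O}_{\mathscr{E},\mathscr{R}},$$ with Frobenius $\varphi_{\mathfrak{M}}\otimes(\varphi\otimes 1)$ on the target, is fully faithful. -/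

import Mathlib

open CategoryTheory
open scoped TensorProduct

universe u

set_option linter.unusedSectionVars false

namespace BreuilKisin

noncomputable section

section Rings

variable (p : ℕ) [Fact p.Prime] (k : Type u) [CommRing k] [CharP k p]

/-- The `ℤ_p`-algebra structure on `W(k)`, i.e. `ℤ_p = W(𝔽_p) → W(k)`. -/
instance algebraWitt : Algebra ℤ_[p] (WittVector p k) :=
  ((WittVector.map (ZMod.castHom (dvd_refl p) k)).comp
    (WittVector.equiv p).symm.toRingHom).toAlgebra

lemma frobenius_algebraMap (z : ℤ_[p]) :
    WittVector.frobenius (algebraMap ℤ_[p] (WittVector p k) z) = algebraMap ℤ_[p] _ z := by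
  change WittVector.frobenius (WittVector.map (ZMod.castHom (dvd_refl p) k) _) =
    WittVector.map (ZMod.castHom (dvd_refl p) k) _
  ext n
  simp only [WittVector.coeff_frobenius_charP, WittVector.map_coeff, ← map_pow]
  rw [ZMod.pow_card]

/-- `𝔖 = W(k)[[u]]`. -/
abbrev BKRing : Type u := PowerSeries (WittVector p k)

/-- The endomorphism `φ` of `𝔖 = W(k)[[u]]` which is the Frobenius on `W(k)` and maps `u` to
`u ^ p`, i.e. `∑ aᵢ uⁱ ↦ ∑ F(aᵢ) u^{pi}`. It is `ℤ_p`-linear. -/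
def phiS : BKRing p k →ₐ[ℤ_[p]] BKRing p k where
  __ := (PowerSeries.expand p (NeZero.ne p)).toRingHom.comp (PowerSeries.map WittVector.frobenius)
  commutes' z := by
    simp [PowerSeries.algebraMap_apply, frobenius_algebraMap, PowerSeries.expand_C]

lemma phiS_C (a : WittVector p k) :
    phiS p k (PowerSeries.C a) = PowerSeries.C (WittVector.frobenius a) := by
  change PowerSeries.expand p (NeZero.ne p) (PowerSeries.map WittVector.frobenius _) = _
  rw [PowerSeries.map_C, PowerSeries.expand_C]

lemma phiS_X : phiS p k PowerSeries.X = PowerSeries.X ^ p := by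
  change PowerSeries.expand p (NeZero.ne p) (PowerSeries.map WittVector.frobenius _) = _
  rw [PowerSeries.map_X, PowerSeries.expand_X]

/-- `𝔖[1/u]`. -/
abbrev BKRingInv : Type u := Localization.Away (PowerSeries.X : BKRing p k)

/-- The extension of `φ` to `𝔖[1/u]`. -/
def phiSInv : BKRingInv p k →+* BKRingInv p k :=
  IsLocalization.Away.lift (PowerSeries.X : BKRing p k)
    (g := (algebraMap (BKRing p k) (BKRingInv p k)).comp (phiS p k).toRingHom)
    (by
      change IsUnit (algebraMap (BKRing p k) (BKRingInv p k) (phiS p k PowerSeries.X))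
      rw [phiS_X, map_pow]
      exact (IsLocalization.Away.algebraMap_isUnit _).pow p)

lemma phiSInv_algebraMap (x : BKRing p k) :
    phiSInv p k (algebraMap _ _ x) = algebraMap _ _ (phiS p k x) :=
  IsLocalization.Away.lift_eq _ _ _

/-- The ideal `(p)` of `𝔖[1/u]`. -/
abbrev idealP : Ideal (BKRingInv p k) := Ideal.span {(p : BKRingInv p k)}

/-- `O_ℰ`, the `p`-adic completion of `𝔖[1/u]`. -/
def OE : Type u := AdicCompletion (idealP p k) (BKRingInv p k)

instance : CommRing (OE p k) :=
  inferInstanceAs (CommRing (AdicCompletion (idealP p k) (BKRingInv p k)))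

instance : Algebra (BKRingInv p k) (OE p k) :=
  inferInstanceAs (Algebra (BKRingInv p k) (AdicCompletion (idealP p k) (BKRingInv p k)))

instance : Algebra (BKRing p k) (OE p k) :=
  ((algebraMap (BKRingInv p k) (OE p k)).comp (algebraMap (BKRing p k) (BKRingInv p k))).toAlgebra

instance : Algebra ℤ_[p] (OE p k) :=
  ((algebraMap (BKRing p k) (OE p k)).comp (algebraMap ℤ_[p] (BKRing p k))).toAlgebra

instance : IsScalarTower ℤ_[p] (BKRing p k) (OE p k) := .of_algebraMap_eq' rfl

lemma idealP_pow_le (n : ℕ) : idealP p k ^ n ≤ (idealP p k ^ n).comap (phiSInv p k) := by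
  rw [← Ideal.map_le_iff_le_comap, Ideal.map_pow, Ideal.map_span, Set.image_singleton,
    map_natCast]

/-- The map `O_ℰ → 𝔖[1/u] / p ^ n → 𝔖[1/u] / p ^ n`, the second map being induced by `φ`. -/
def phiLevel (n : ℕ) : AdicCompletion (idealP p k) (BKRingInv p k) →+*
    BKRingInv p k ⧸ idealP p k ^ n :=
  (Ideal.quotientMap (idealP p k ^ n) (phiSInv p k) (idealP_pow_le p k n)).comp
    (AdicCompletion.evalₐ (idealP p k) n).toRingHom

lemma phiLevel_compat {m n : ℕ} (hle : m ≤ n) :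
    (Ideal.Quotient.factorPow (idealP p k) hle).comp (phiLevel p k n) = phiLevel p k m := by
  ext x
  induction x using AdicCompletion.induction_on with
  | h a =>
  change Ideal.Quotient.factorPow _ hle (Ideal.quotientMap _ _ (idealP_pow_le p k n)
    (AdicCompletion.evalₐ (idealP p k) n (AdicCompletion.mk _ _ a))) = Ideal.quotientMap _ _ (idealP_pow_le p k m)
    (AdicCompletion.evalₐ (idealP p k) m (AdicCompletion.mk _ _ a))
  rw [AdicCompletion.evalₐ_mk, AdicCompletion.evalₐ_mk, Ideal.quotientMap_mk,
    Ideal.quotientMap_mk]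
  refine Ideal.Quotient.eq.mpr ?_
  rw [← map_sub]
  refine idealP_pow_le p k m ?_
  have := (a.2 hle).symm
  rw [SModEq.sub_mem, smul_eq_mul, Ideal.mul_top] at this
  exact this

/-- The extension of `φ` to the `p`-adic completion `O_ℰ` of `𝔖[1/u]`, as a ring homomorphism:
modulo `p ^ n` it is induced by `φ` on `𝔖[1/u]`. -/
def phiOERingHom : OE p k →+* OE p k :=
  AdicCompletion.liftRingHom (idealP p k) (phiLevel p k) (phiLevel_compat p k)

lemma phiOERingHom_algebraMap (x : BKRing p k) :
    phiOERingHom p k (algebraMap _ _ x) = algebraMap _ _ (phiS p k x) := by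
  apply AdicCompletion.ext_evalₐ
  intro n
  refine (AdicCompletion.evalₐ_liftRingHom _ _ (phiLevel_compat p k) _ _).trans ?_
  change Ideal.quotientMap _ _ (idealP_pow_le p k n) (AdicCompletion.evalₐ (idealP p k) n
    (algebraMap (BKRingInv p k) (AdicCompletion (idealP p k) (BKRingInv p k))
      (algebraMap _ _ x))) = AdicCompletion.evalₐ (idealP p k) n
    (algebraMap (BKRingInv p k) (AdicCompletion (idealP p k) (BKRingInv p k))
      (algebraMap _ _ (phiS p k x)))
  rw [AlgHom.commutes, AlgHom.commutes, ← phiSInv_algebraMap]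
  rfl

/-- The endomorphism `φ` of `O_ℰ`. -/
def phiOE : OE p k →ₐ[ℤ_[p]] OE p k where
  __ := phiOERingHom p k
  commutes' z := by
    change phiOERingHom p k (algebraMap (BKRing p k) _ (algebraMap _ _ z)) =
      (algebraMap (BKRing p k) _ (algebraMap _ _ z))
    rw [phiOERingHom_algebraMap, AlgHom.commutes]

lemma phiOE_algebraMap (x : BKRing p k) :
    phiOE p k (algebraMap _ _ x) = algebraMap _ _ (phiS p k x) :=
  phiOERingHom_algebraMap p k x

lemma isUnit_X (p : ℕ) [Fact p.Prime] (k : Type u) [CommRing k] : IsUnit (algebraMap (BKRing p k) (OE p k) PowerSeries.X) :=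
  (IsLocalization.Away.algebraMap_isUnit (PowerSeries.X : BKRing p k)).map
    (algebraMap (BKRingInv p k) (OE p k))

/-- An element of `𝔖` which is a power of `u` modulo `p` is invertible in `O_ℰ`. -/
lemma isUnit_of_sub_mem {E : BKRing p k} {n : ℕ} (hE : (p : BKRing p k) ∣ E - PowerSeries.X ^ n) :
    IsUnit (algebraMap (BKRing p k) (OE p k) E) := by
  obtain ⟨s, hs⟩ := hE
  have hc : IsAdicComplete ((idealP p k).map (algebraMap (BKRingInv p k)
      (AdicCompletion (idealP p k) (BKRingInv p k))))
      (AdicCompletion (idealP p k) (BKRingInv p k)) :=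
    (IsAdicComplete.map_algebraMap_iff _ _).mpr
      (AdicCompletion.isAdicComplete ⟨{_}, by rw [Finset.coe_singleton]⟩)
  have hJ := IsAdicComplete.le_jacobson_bot ((idealP p k).map (algebraMap (BKRingInv p k)
      (AdicCompletion (idealP p k) (BKRingInv p k))))
  have hp : (p : OE p k) ∈ (⊥ : Ideal (OE p k)).jacobson := by
    apply hJ
    rw [Ideal.map_span, Set.image_singleton, map_natCast]
    exact Ideal.mem_span_singleton_self _
  obtain ⟨v, hv⟩ := ((isUnit_X p k).pow n).exists_left_inv
  have h1 := Ideal.mem_jacobson_bot.mp hp (v * algebraMap _ _ s)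
  have h2 : v * algebraMap (BKRing p k) (OE p k) E =
      (p : OE p k) * (v * algebraMap _ _ s) + 1 := by
    rw [sub_eq_iff_eq_add.mp hs, map_add, map_mul, map_natCast, map_pow, mul_add, hv]
    ring
  rw [← h2] at h1
  exact isUnit_of_mul_isUnit_right h1

end Rings

/-- The residue ring `κ = O / π O`. -/
abbrev Residue {O : Type u} [CommRing O] (π : O) : Type u := O ⧸ Ideal.span {π}

lemma hasFiniteQuotients (p : ℕ) [Fact p.Prime] (O : Type u) [CommRing O] [IsDomain O]
    [Algebra ℤ_[p] O] [Module.Finite ℤ_[p] O] : Ring.HasFiniteQuotients O := by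
  have : Ring.HasFiniteQuotients ℤ_[p] := by
    constructor
    intro I hI
    obtain ⟨n, rfl⟩ := PadicInt.ideal_eq_span_pow_p hI
    rw [← PadicInt.ker_toZModPow]
    exact Finite.of_equiv _ (RingHom.quotientKerEquivOfSurjective
      (f := PadicInt.toZModPow (p := p) n) (ZMod.ringHom_surjective _)).symm.toEquiv
  exact Ring.HasFiniteQuotients.of_module_finite ℤ_[p] O

lemma finite_residue (p : ℕ) [Fact p.Prime] {O : Type u} [CommRing O] [IsDomain O]
    [Algebra ℤ_[p] O] [Module.Finite ℤ_[p] O] (π : O) (hπ : Prime π) : Finite (Residue π) := by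
  have := hasFiniteQuotients p O
  exact Ring.HasFiniteQuotients.finiteQuotient (by simpa using hπ.ne_zero)

section Residue

variable (p : ℕ) [hp : Fact p.Prime] {O : Type u} [CommRing O]

lemma natCast_mem [IsDomain O] [Algebra ℤ_[p] O] [Module.Finite ℤ_[p] O] (π : O) (hπ : Prime π) : (p : O) ∈ Ideal.span {π} := by
  have hprime : (Ideal.span {π}).IsPrime := (Ideal.span_singleton_prime hπ.ne_zero).mpr hπ
  have hne := Ideal.comap_ne_bot_of_integral_mem (R := ℤ_[p]) hπ.ne_zero
    (Ideal.mem_span_singleton_self π) (Algebra.IsIntegral.isIntegral π)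
  have h2 : ((Ideal.span {π}).comap (algebraMap ℤ_[p] O)).IsMaximal :=
    (Ideal.IsPrime.comap _).isMaximal hne
  have h3 := IsLocalRing.eq_maximalIdeal h2
  have h4 : (p : ℤ_[p]) ∈ (Ideal.span {π}).comap (algebraMap ℤ_[p] O) := by
    rw [h3, PadicInt.maximalIdeal_eq_span_p]
    exact Ideal.mem_span_singleton_self _
  simpa using h4

lemma isDomain_residue {π : O} (hπ : Prime π) : IsDomain (Residue π) :=
  have := (Ideal.span_singleton_prime hπ.ne_zero).mpr hπ
  Ideal.Quotient.isDomain _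

lemma charP_residue [IsDomain O] [Algebra ℤ_[p] O] [Module.Finite ℤ_[p] O]
    (π : O) (hπ : Prime π) : CharP (Residue π) p := by
  have := isDomain_residue hπ
  have h : (p : Residue π) = 0 := by
    rw [← map_natCast (Ideal.Quotient.mk (Ideal.span {π}))]
    exact Ideal.Quotient.eq_zero_iff_mem.mpr (natCast_mem p π hπ)
  exact ringChar.of_eq <| Or.resolve_left ((Nat.dvd_prime hp.1).1 <| ringChar.dvd h) fun h1 ↦
    CharP.ringChar_ne_one h1

lemma perfectRing_residue [IsDomain O] [Algebra ℤ_[p] O] [Module.Finite ℤ_[p] O]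
    (π : O) (hπ : Prime π) :
    letI := charP_residue p π hπ
    PerfectRing (Residue π) p := by
  have := finite_residue p π hπ
  have := isDomain_residue hπ
  have := charP_residue p π hπ
  exact PerfectRing.ofFiniteOfIsReduced p _

lemma not_isUnit_p [IsDomain O] [Algebra ℤ_[p] O] [Module.Finite ℤ_[p] O]
    (π : O) (hπ : Prime π) : ¬ IsUnit (p : O) := fun h ↦ hπ.not_isUnit
  (isUnit_of_dvd_unit (Ideal.mem_span_singleton.mp (natCast_mem p π hπ)) h)

/-- `O` is `p`-adically complete. -/
lemma isAdicComplete_p [Algebra ℤ_[p] O] [Module.Finite ℤ_[p] O] : IsAdicComplete (Ideal.span {(p : O)}) O := by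
  have h : Ideal.span {(p : O)} = (Ideal.span {(p : ℤ_[p])}).map (algebraMap ℤ_[p] O) := by
    rw [Ideal.map_span, Set.image_singleton, map_natCast]
  rw [h, IsAdicComplete.map_algebraMap_iff]
  have hZ : IsAdicComplete (Ideal.span {(p : ℤ_[p])}) ℤ_[p] := by
    rw [← PadicInt.maximalIdeal_eq_span_p]; infer_instance
  rw [← PadicInt.maximalIdeal_eq_span_p] at hZ ⊢
  refine { toIsHausdorff := inferInstance, toIsPrecomplete := ?_ }
  rw [← AdicCompletion.of_surjective_iff]
  intro x
  obtain ⟨y, rfl⟩ := AdicCompletion.ofTensorProduct_surjective_of_finite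
    (IsLocalRing.maximalIdeal ℤ_[p]) O x
  induction y with
  | zero => exact ⟨0, by simp⟩
  | add x y hx hy =>
    obtain ⟨a, ha⟩ := hx
    obtain ⟨b, hb⟩ := hy
    exact ⟨a + b, by rw [map_add, map_add, ha, hb]⟩
  | tmul r m =>
    obtain ⟨r, rfl⟩ := (AdicCompletion.of_bijective (IsLocalRing.maximalIdeal ℤ_[p]) ℤ_[p]).2 r
    refine ⟨r • m, ?_⟩
    rw [AdicCompletion.ofTensorProduct_tmul, map_smul]
    exact (algebraMap_smul (AdicCompletion (IsLocalRing.maximalIdeal ℤ_[p]) ℤ_[p]) r _).symm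

/-- `π` is nilpotent modulo `p`. -/
lemma exists_pow_mem [IsDomain O] [CharZero O] [Algebra ℤ_[p] O] [Module.Finite ℤ_[p] O]
    (π : O) (hπ : Prime π) : ∃ N : ℕ, π ^ N ∈ Ideal.span {(p : O)} := by
  have := hasFiniteQuotients p O
  have hfin : Finite (O ⧸ Ideal.span {(p : O)}) :=
    Ring.HasFiniteQuotients.finiteQuotient (by simpa using hp.out.ne_zero)
  have := isAdicComplete_p p (O := O)
  have hens : HenselianRing O (Ideal.span {(p : O)}) := inferInstance
  let x : O ⧸ Ideal.span {(p : O)} := Ideal.Quotient.mk _ π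
  obtain ⟨a, b, hab, h⟩ := Set.finite_univ.exists_lt_map_eq_of_forall_mem
    (f := fun n : ℕ ↦ x ^ (n + 1)) (fun _ ↦ Set.mem_univ _)
  obtain ⟨c, rfl⟩ := Nat.exists_eq_add_of_lt hab
  have h1 (m : ℕ) : x ^ (a + 1 + m) = x ^ (a + 1 + m + (c + 1)) := by
    have : x ^ (a + 1) = x ^ (a + 1 + (c + 1)) := by simpa [add_assoc, add_comm, add_left_comm] using h
    rw [pow_add, this, ← pow_add]; congr 1; ring
  have h2 (m j : ℕ) : x ^ (a + 1 + m) = x ^ (a + 1 + m + j * (c + 1)) := by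
    induction j with
    | zero => simp
    | succ j ih => rw [ih, add_assoc (a + 1) m, h1]; congr 1; ring
  have hidem : x ^ ((a + 1) * (c + 1)) * x ^ ((a + 1) * (c + 1)) = x ^ ((a + 1) * (c + 1)) := by
    rw [← pow_add]
    have := h2 ((a + 1) * c) (a + 1)
    rw [show (a + 1) * (c + 1) = a + 1 + (a + 1) * c by ring] at *
    exact this.symm
  set N := (a + 1) * (c + 1) with hN
  refine ⟨N, ?_⟩
  obtain ⟨e, he, heN⟩ := hens.is_henselian (Polynomial.X ^ 2 - Polynomial.X)
    (by monicity!) (π ^ N) (by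
      rw [← Ideal.Quotient.eq_zero_iff_mem]
      simp only [Polynomial.eval_sub, Polynomial.eval_pow, Polynomial.eval_X, map_sub, map_pow]
      rw [sq, hidem, sub_self]) (by
      refine IsUnit.of_mul_eq_one (Ideal.Quotient.mk _ (2 * π ^ N - 1)) ?_
      simp only [Polynomial.derivative_X_pow, Polynomial.derivative_X,
        Polynomial.eval_sub, Polynomial.eval_mul, Polynomial.eval_one, map_sub, map_pow, map_mul,
        map_one]
      have h3 : (Ideal.Quotient.mk (Ideal.span {(p : O)}) π) ^ N *
        (Ideal.Quotient.mk (Ideal.span {(p : O)}) π) ^ N =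
        (Ideal.Quotient.mk (Ideal.span {(p : O)}) π) ^ N := hidem
      simp only [map_ofNat, Polynomial.eval_X, Polynomial.eval_ofNat,
        map_pow, Nat.cast_ofNat, Nat.add_one_sub_one, pow_one]
      linear_combination 4 * h3)
  have he' : e * (e - 1) = 0 := by
    have : e ^ 2 - e = 0 := by simpa using he
    linear_combination this
  rcases mul_eq_zero.mp he' with h0 | h1
  · rw [h0, zero_sub, neg_mem_iff] at heN
    exact heN
  · exfalso
    rw [sub_eq_zero.mp h1] at heN
    have h5 : Ideal.span {(p : O)} ≤ Ideal.span {π} := by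
      rw [Ideal.span_singleton_le_iff_mem]
      exact natCast_mem p π hπ
    have h6 := Ideal.mem_span_singleton.mp (h5 heN)
    have h7 : π ∣ π ^ N := dvd_pow_self π (by positivity)
    exact hπ.not_isUnit (isUnit_of_dvd_one ((dvd_sub_left h7).mp h6))

end Residue

section Witt

variable (p : ℕ) [hp : Fact p.Prime] {O : Type u} [CommRing O] [Fact (¬ IsUnit (p : O))] {π : O}

/-- The map `lim_{x ↦ x^p} O / p → O / p → O / π` for `p ∈ π O`. -/
def tiltToResidue (h : (p : O) ∈ Ideal.span {π}) : PreTilt O p →+* Residue π :=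
  (Ideal.Quotient.factor ((Ideal.span_singleton_le_iff_mem _).mpr h)).comp (PreTilt.coeff 0)

lemma tiltToResidue_bijective [IsDomain (Residue π)] [CharP (Residue π) p]
    [PerfectRing (Residue π) p] (h : (p : O) ∈ Ideal.span {π})
    (hN : ∃ N, π ^ N ∈ Ideal.span {(p : O)}) : Function.Bijective (tiltToResidue p h) := by
  obtain ⟨N, hN⟩ := hN
  have hle := (Ideal.span_singleton_le_iff_mem _).mpr h
  let q : ModP O p →+* Residue π := Ideal.Quotient.factor hle
  have hq : Function.Surjective q := Ideal.Quotient.factor_surjective hle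
  have hchar : CharP (ModP O p) p := inferInstance
  have hker (x : ModP O p) (hx : q x = 0) : x ^ p ^ N = 0 := by
    obtain ⟨y, rfl⟩ := Ideal.Quotient.mk_surjective x
    have hy : y ∈ Ideal.span {π} := Ideal.Quotient.eq_zero_iff_mem.mp hx
    obtain ⟨z, rfl⟩ := Ideal.mem_span_singleton.mp hy
    refine pow_eq_zero_of_le (m := N) (Nat.lt_pow_self hp.out.one_lt).le ?_
    rw [← map_pow, mul_pow]
    exact Ideal.Quotient.eq_zero_iff_mem.mpr (Ideal.mul_mem_right _ _ hN)
  have hsub (x y : ModP O p) (hxy : q x = q y) : x ^ p ^ N = y ^ p ^ N := by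
    rw [← sub_eq_zero, ← sub_pow_expChar_pow]
    exact hker _ (by rw [map_sub, hxy, sub_self])
  constructor
  · rw [injective_iff_map_eq_zero]
    intro t ht
    refine Perfection.ext fun n ↦ ?_
    change PreTilt.coeff n t = PreTilt.coeff n 0
    rw [map_zero]
    have h1 (n : ℕ) : q (PreTilt.coeff n t) = 0 := by
      have : (PreTilt.coeff n t) ^ p ^ n = PreTilt.coeff 0 t := by
        induction n with
        | zero => simp
        | succ n ih => rw [← ih, pow_succ', pow_mul]; congr 1; exact Perfection.coeff_pow_p' t n
      refine eq_zero_of_pow_eq_zero (n := p ^ n) ?_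
      rw [← map_pow, this]
      exact ht
    have h2 (m : ℕ) : (PreTilt.coeff (n + m) t) ^ p ^ m = PreTilt.coeff n t := by
      induction m with
      | zero => simp
      | succ m ih => rw [← ih, pow_succ', pow_mul]; congr 1; exact Perfection.coeff_pow_p' t (n + m)
    rw [← h2 N]
    exact hker _ (h1 _)
  · intro y
    let r (n : ℕ) : ModP O p := Function.surjInv hq ((frobeniusEquiv (Residue π) p).symm^[n] y)
    have hr (n : ℕ) : q (r n) = (frobeniusEquiv (Residue π) p).symm^[n] y :=
      Function.surjInv_eq hq _
    have hr' (n : ℕ) : q (r n) ^ p ^ n = y := by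
      rw [hr]
      induction n with
      | zero => simp
      | succ n ih =>
        rw [Function.iterate_succ_apply', pow_succ', pow_mul]
        have : ((frobeniusEquiv (Residue π) p).symm
          ((frobeniusEquiv (Residue π) p).symm^[n] y)) ^ p =
          (frobeniusEquiv (Residue π) p).symm^[n] y := by
          rw [← frobenius_def, ← coe_frobeniusEquiv, RingEquiv.apply_symm_apply]
        rw [this, ih]
    have hr'' (n : ℕ) : q (r (n + 1)) ^ p = q (r n) := by
      rw [hr, hr, Function.iterate_succ_apply', ← frobenius_def, ← coe_frobeniusEquiv, RingEquiv.apply_symm_apply]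
    let t : PreTilt O p := ⟨fun n ↦ r (n + N) ^ p ^ N, fun n ↦ by
      rw [← pow_mul, mul_comm, pow_mul]
      refine hsub _ _ ?_
      rw [map_pow, show n + 1 + N = n + N + 1 by ring, hr'']⟩
    refine ⟨t, ?_⟩
    change q (r (0 + N) ^ p ^ N) = y
    rw [map_pow, zero_add, hr']

/-- The canonical ring homomorphism `W(O / π) → O` for a `p`-adically complete ring `O` and
`π` with `p ∈ π O`, where `O / π ≅ lim_{x ↦ x^p} O / p`. -/
def wittToRing [IsAdicComplete (Ideal.span {(p : O)}) O] (h : (p : O) ∈ Ideal.span {π})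
    (hb : Function.Bijective (tiltToResidue p h)) : WittVector p (Residue π) →+* O :=
  (WittVector.fontaineTheta O p).comp
    (WittVector.map (RingEquiv.ofBijective (tiltToResidue p h) hb).symm.toRingHom)

/-- `W(O / π) → O` induces the identity on the residue ring `O / π`. -/
lemma mk_wittToRing [IsAdicComplete (Ideal.span {(p : O)}) O] (h : (p : O) ∈ Ideal.span {π})
    (hb : Function.Bijective (tiltToResidue p h)) (x : WittVector p (Residue π)) :
    Ideal.Quotient.mk (Ideal.span {π}) (wittToRing p h hb x) = x.coeff 0 := by
  have h1 := WittVector.mk_fontaineTheta (R := O) (p := p)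
    (WittVector.map (RingEquiv.ofBijective (tiltToResidue p h) hb).symm.toRingHom x)
  have h2 := congrArg (Ideal.Quotient.factor ((Ideal.span_singleton_le_iff_mem _).mpr h)) h1
  refine h2.trans ?_
  rw [WittVector.map_coeff]
  exact (RingEquiv.ofBijective (tiltToResidue p h) hb).apply_symm_apply _

end Witt

section Minpoly

variable (p : ℕ) [hp : Fact p.Prime] {O : Type u} [CommRing O] [IsDomain O] [CharZero O]
  [Algebra ℤ_[p] O] [Module.Finite ℤ_[p] O] {π : O} [CharP (Residue π) p]
  [PerfectRing (Residue π) p] [Algebra (WittVector p (Residue π)) O]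

/-- Two ring homomorphisms from `ℤ_p` to `O` agree. -/
lemma ringHom_padicInt_eq (f g : ℤ_[p] →+* O) : f = g := by
  have := isAdicComplete_p p (O := O)
  ext z
  rw [← sub_eq_zero]
  refine IsHausdorff.haus (I := Ideal.span {(p : O)}) inferInstance _ fun n ↦ ?_
  rw [SModEq.zero, smul_eq_mul, Ideal.mul_top, Ideal.span_singleton_pow, Ideal.mem_span_singleton]
  obtain ⟨w, hw⟩ := Ideal.mem_span_singleton.mp (PadicInt.appr_spec n z)
  have hz : z = (PadicInt.appr z n : ℤ_[p]) + (p : ℤ_[p]) ^ n * w := by rw [← hw]; ring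
  refine ⟨f w - g w, ?_⟩
  rw [hz]
  simp only [map_add, map_mul, map_pow, map_natCast]
  ring

lemma finite_witt : Module.Finite (WittVector p (Residue π)) O := by
  have : IsScalarTower ℤ_[p] (WittVector p (Residue π)) O :=
    .of_algebraMap_eq' (ringHom_padicInt_eq p _ _)
  exact Module.Finite.of_restrictScalars_finite ℤ_[p] (WittVector p (Residue π)) O

lemma exists_monic (hπ : Prime π) (hmk : ∀ x : WittVector p (Residue π),
    Ideal.Quotient.mk (Ideal.span {π}) (algebraMap (WittVector p (Residue π)) O x) = x.coeff 0) :
    ∃ (N : ℕ) (G : Polynomial (WittVector p (Residue π))), G.degree < N ∧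
    Polynomial.aeval π (Polynomial.X ^ N - Polynomial.C (p : WittVector p (Residue π)) * G) = 0 := by
  obtain ⟨N, hN⟩ := exists_pow_mem p π hπ
  have hfin := finite_witt p (π := π)
  have key (n : ℕ) (y : O) : ∃ (G : Polynomial (WittVector p (Residue π))) (z : O),
      G.degree < n ∧ y = Polynomial.aeval π G + π ^ n * z := by
    induction n with
    | zero => exact ⟨0, y, by simp, by simp⟩
    | succ n ih =>
      obtain ⟨G, z, hG, rfl⟩ := ih
      let w : WittVector p (Residue π) :=
        WittVector.teichmuller p (Ideal.Quotient.mk (Ideal.span {π}) z)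
      have hw : z - algebraMap _ O w ∈ Ideal.span {π} := by
        rw [← Ideal.Quotient.eq_zero_iff_mem, map_sub, hmk, WittVector.teichmuller_coeff_zero,
          sub_self]
      obtain ⟨z', hz'⟩ := Ideal.mem_span_singleton.mp hw
      refine ⟨G + Polynomial.C w * Polynomial.X ^ n, z', ?_, ?_⟩
      · refine (Polynomial.degree_add_le _ _).trans_lt (max_lt ?_ ?_)
        · exact hG.trans (by exact_mod_cast n.lt_succ_self)
        · exact (Polynomial.degree_C_mul_X_pow_le n w).trans_lt (by exact_mod_cast n.lt_succ_self)
      · rw [map_add, map_mul, Polynomial.aeval_C, map_pow, Polynomial.aeval_X,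
          sub_eq_iff_eq_add.mp hz']
        ring
  let M : Submodule (WittVector p (Residue π)) O :=
    (Polynomial.degreeLT (WittVector p (Residue π)) N).map (Polynomial.aeval π).toLinearMap
  have hM : (⊤ : Submodule (WittVector p (Residue π)) O) ≤ M := by
    refine Submodule.le_of_le_smul_of_le_jacobson_bot
      (I := Ideal.span {(p : WittVector p (Residue π))}) hfin.fg_top
      (IsAdicComplete.le_jacobson_bot _) ?_
    intro y _
    obtain ⟨G, z, hG, rfl⟩ := key N y
    refine Submodule.add_mem_sup ⟨G, Polynomial.mem_degreeLT.mpr hG, rfl⟩ ?_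
    obtain ⟨t, ht⟩ := Ideal.mem_span_singleton.mp hN
    have : π ^ N * z = (p : WittVector p (Residue π)) • (t * z) := by
      rw [ht, Algebra.smul_def, map_natCast, mul_assoc]
    rw [this]
    exact Submodule.smul_mem_smul (Ideal.mem_span_singleton_self _) trivial
  obtain ⟨t, ht⟩ := Ideal.mem_span_singleton.mp hN
  obtain ⟨G, hG, rfl⟩ := hM (Submodule.mem_top (x := t))
  refine ⟨N, G, Polynomial.mem_degreeLT.mp hG, ?_⟩
  rw [map_sub, map_mul, map_pow, Polynomial.aeval_X, Polynomial.aeval_C, ht, map_natCast]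
  exact sub_self _

/-- The minimal polynomial of `π` over `W(κ)` is a power of the variable modulo `p`. -/
lemma minpoly_mod_p (hπ : Prime π) (hmk : ∀ x : WittVector p (Residue π),
    Ideal.Quotient.mk (Ideal.span {π}) (algebraMap (WittVector p (Residue π)) O x) = x.coeff 0) :
    ∃ n : ℕ, Polynomial.C (p : WittVector p (Residue π)) ∣
      minpoly (WittVector p (Residue π)) π - Polynomial.X ^ n := by
  obtain ⟨N, G, hG, h0⟩ := exists_monic p hπ hmk
  have hfin := finite_witt p (π := π)
  have hdom := isDomain_residue hπ
  have hfin' := finite_residue p π hπ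
  have hmax : (Ideal.span {π}).IsMaximal :=
    Ideal.Quotient.maximal_of_isField _ (Finite.isField_of_domain (Residue π))
  have hDVR : IsDiscreteValuationRing (WittVector p (Residue π)) := by
    let _ : Field (Residue π) := Ideal.Quotient.field (Ideal.span {π})
    exact WittVector.isDiscreteValuationRing (k := Residue π) (p := p)
  have hinj : Function.Injective (algebraMap (WittVector p (Residue π)) O) := by
    rw [injective_iff_map_eq_zero]
    intro a ha
    by_contra hne
    obtain ⟨m, b, hb, rfl⟩ := WittVector.exists_eq_pow_p_mul a hne
    rw [map_mul, map_pow, map_natCast] at ha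
    have hb0 := (mul_eq_zero.mp ha).resolve_left
      (pow_ne_zero _ (Nat.cast_ne_zero.mpr hp.out.ne_zero))
    apply hb
    rw [← hmk, hb0, map_zero]
  have htf : Module.IsTorsionFree (WittVector p (Residue π)) O := by
    rw [Module.isTorsionFree_iff_algebraMap_injective]
    exact hinj
  have hint : IsIntegral (WittVector p (Residue π)) π := Algebra.IsIntegral.isIntegral π
  have hdvd := minpoly.isIntegrallyClosed_dvd hint h0
  let c : WittVector p (Residue π) →+* Residue π := WittVector.constantCoeff
  have hc (x : WittVector p (Residue π)) : c x = x.coeff 0 := rfl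
  have hcp : c p = 0 := by rw [map_natCast, CharP.cast_eq_zero]
  have h1 := Polynomial.map_dvd c hdvd
  rw [Polynomial.map_sub, Polynomial.map_mul, Polynomial.map_C, hcp, map_zero, zero_mul, sub_zero,
    Polynomial.map_pow, Polynomial.map_X] at h1
  obtain ⟨n, -, hn⟩ := (dvd_prime_pow Polynomial.prime_X _).mp h1
  have hn' := Polynomial.eq_of_monic_of_associated ((minpoly.monic hint).map c)
    (Polynomial.monic_X_pow n) hn
  refine ⟨n, ?_⟩
  rw [Polynomial.C_dvd_iff_dvd_coeff]
  intro i
  rw [← Ideal.mem_span_singleton, WittVector.mem_span_p_iff_coeff_zero_eq_zero]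
  rw [← hc, ← Polynomial.coeff_map, Polynomial.map_sub, hn', Polynomial.map_pow, Polynomial.map_X,
    sub_self, Polynomial.coeff_zero]

end Minpoly

/-- The ring `A`, regarded as an `A`-algebra through the endomorphism `φ`. -/
def FrobTwist {A : Type u} [CommRing A] (_φ : A →+* A) : Type u := A

instance {A : Type u} [CommRing A] (φ : A →+* A) : CommRing (FrobTwist φ) :=
  inferInstanceAs (CommRing A)

instance {A : Type u} [CommRing A] (φ : A →+* A) : Algebra A (FrobTwist φ) :=
  RingHom.toAlgebra (S := FrobTwist φ) φ

/-- The identity map from `A` with its twisted `A`-algebra structure to `A`, as a ring isomorphism. -/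
def FrobTwist.untwist {A : Type u} [CommRing A] (φ : A →+* A) : FrobTwist φ ≃+* A :=
  RingEquiv.refl A

lemma FrobTwist.untwist_smul {A : Type u} [CommRing A] (φ : A →+* A) (a : A) (c : FrobTwist φ) :
    untwist φ (a • c) = φ a * untwist φ c := rfl

section Linearization

variable {A : Type u} [CommRing A] (φ : A →+* A) {M : Type u} [AddCommGroup M] [Module A M]

/-- The linearization `1 ⊗ f : φ^*M = A ⊗_{φ, A} M → M`, `a ⊗ m ↦ a • f m`, of a `φ`-semilinear
endomorphism `f` of `M`. -/
def linearization (f : M →ₛₗ[φ] M) : FrobTwist φ ⊗[A] M →+ M :=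
  (TensorProduct.lift (LinearMap.mk₂'ₛₗ φ φ
    (fun (a : FrobTwist φ) (m : M) ↦ FrobTwist.untwist φ a • f m)
    (fun a b m ↦ by rw [map_add, add_smul])
    (fun c a m ↦ by rw [FrobTwist.untwist_smul, mul_smul])
    (fun a m n ↦ by rw [map_add, smul_add])
    (fun c a m ↦ by rw [map_smulₛₗ, smul_comm]))).toAddMonoidHom

@[simp]
lemma linearization_tmul (f : M →ₛₗ[φ] M) (a : FrobTwist φ) (m : M) :
    linearization φ f (a ⊗ₜ m) = FrobTwist.untwist φ a • f m := rfl

lemma linearization_smul (f : M →ₛₗ[φ] M) (a : FrobTwist φ) (x : FrobTwist φ ⊗[A] M) :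
    linearization φ f (a • x) = FrobTwist.untwist φ a • linearization φ f x := by
  induction x with
  | zero => simp
  | tmul b m => simp [TensorProduct.smul_tmul', mul_smul]
  | add x y hx hy => simp [hx, hy]

/-- If `M` is finite free, a surjective linearization is bijective. -/
lemma linearization_bijective [Module.Free A M] [Module.Finite A M] (f : M →ₛₗ[φ] M)
    (hf : Function.Surjective (linearization φ f)) : Function.Bijective (linearization φ f) := by
  classical
  rcases subsingleton_or_nontrivial A with hA | hA
  · have : Subsingleton M := Module.subsingleton A M
    have : Subsingleton (FrobTwist φ) := hA
    have : Subsingleton (FrobTwist φ ⊗[A] M) := Module.subsingleton (FrobTwist φ) _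
    exact ⟨Function.injective_of_subsingleton _, hf⟩
  let b := Module.Free.chooseBasis A M
  let b' := (b.baseChange (FrobTwist φ)).equivFun
  let t : (Module.Free.ChooseBasisIndex A M → A) ≃+ (Module.Free.ChooseBasisIndex A M → FrobTwist φ) :=
    AddEquiv.piCongrRight fun _ ↦ (FrobTwist.untwist φ).symm.toAddEquiv
  have ht (a : A) (x) : t (a • x) = (FrobTwist.untwist φ).symm a • t x := rfl
  let g : (Module.Free.ChooseBasisIndex A M → A) →ₗ[A] M :=
    { toFun := fun x ↦ linearization φ f (b'.symm (t x))
      map_add' := fun x y ↦ by rw [map_add, map_add, map_add]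
      map_smul' := fun a x ↦ by
        rw [ht, map_smul, linearization_smul, RingEquiv.apply_symm_apply]; rfl }
  have hg : Function.Surjective g := hf.comp (b'.symm.surjective.comp t.surjective)
  have h2 : Function.Injective (b.equivFun.toLinearMap.comp g) := by
    apply OrzechProperty.injective_of_surjective_endomorphism
    exact b.equivFun.surjective.comp hg
  have h3 : Function.Injective g := by
    intro x y h
    apply h2
    simp [h]
  refine ⟨fun x y h ↦ ?_, hf⟩
  have key (x) : g (t.symm (b' x)) = linearization φ f x := by
    change linearization φ f (b'.symm (t (t.symm (b' x)))) = _
    rw [AddEquiv.apply_symm_apply, LinearEquiv.symm_apply_apply]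
  have := h3 ((key x).trans (h.trans (key y).symm))
  exact b'.injective (t.symm.injective this)

end Linearization

variable (Z : Type) [CommRing Z]

section

variable {Z} {A : Type u} [CommRing A] [Algebra Z A] (φ : A →ₐ[Z] A)
  (R : Type u) [CommRing R] [Algebra Z R]

/-- The `R`-linear extension `φ ⊗ 1` of `φ` to `A ⊗[Z] R`. -/
def frobR : A ⊗[Z] R →+* A ⊗[Z] R :=
  (Algebra.TensorProduct.map φ (AlgHom.id Z R)).toRingHom

@[simp]
lemma frobR_tmul (a : A) (r : R) : frobR φ R (a ⊗ₜ r) = φ a ⊗ₜ r := rfl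

/-- A `φ`-module over `A` with an action of `R`: an `A`-module with a commuting `Z`-linear action
of `R`, i.e. an `A ⊗[Z] R`-module, together with an `R`-linear and `φ`-semilinear
endomorphism, i.e. an endomorphism which is semilinear for `φ ⊗ 1`.
The `A`-module structure is the one obtained by restriction along `A → A ⊗[Z] R`. -/
structure PhiModule where
  /-- the underlying module -/
  carrier : Type u
  [addCommGroup : AddCommGroup carrier]
  [moduleR : Module (A ⊗[Z] R) carrier]
  [module : Module A carrier]
  [isScalarTower : IsScalarTower A (A ⊗[Z] R) carrier]
  /-- the Frobenius -/
  frob : carrier →ₛₗ[frobR φ R] carrier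

namespace PhiModule

attribute [instance] addCommGroup moduleR module isScalarTower

variable {φ R}

lemma smul_eq (M : PhiModule φ R) (a : A) (m : M.carrier) :
    a • m = (a ⊗ₜ[Z] (1 : R)) • m := by
  rw [← one_smul (A ⊗[Z] R) m, ← smul_assoc, ← smul_assoc, Algebra.TensorProduct.one_def,
    TensorProduct.smul_tmul', smul_eq_mul, mul_one, smul_eq_mul,
    Algebra.TensorProduct.tmul_mul_tmul, mul_one, mul_one]

/-- The Frobenius of a `φ`-module with `R`-action as a `φ`-semilinear map over `A`. -/
def frobA (M : PhiModule φ R) : M.carrier →ₛₗ[(φ : A →+* A)] M.carrier where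
  toFun := M.frob
  map_add' := map_add M.frob
  map_smul' a m := by
    rw [smul_eq, map_smulₛₗ, smul_eq]; rfl

/-- The linearization `1 ⊗ φ_M : A ⊗_{φ, A} M → M` of the Frobenius over `A`. -/
def lin (M : PhiModule φ R) : FrobTwist (φ : A →+* A) ⊗[A] M.carrier →+ M.carrier :=
  linearization (φ : A →+* A) M.frobA

/-- A morphism of `φ`-modules with `R`-action: an `A`-linear and `R`-linear
(i.e. `A ⊗[Z] R`-linear) map which commutes with the Frobenius maps. -/
@[ext]
structure Hom (M N : PhiModule φ R) where
  /-- the underlying linear map -/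
  toLin : M.carrier →ₗ[A ⊗[Z] R] N.carrier
  comm : ∀ m, toLin (M.frob m) = N.frob (toLin m)

instance : Category (PhiModule φ R) where
  Hom := Hom
  id M := ⟨LinearMap.id, fun _ ↦ rfl⟩
  comp f g := ⟨g.toLin ∘ₗ f.toLin, fun m ↦ by simp [f.comm, g.comm]⟩

@[simp]
lemma id_toLin (M : PhiModule φ R) : Hom.toLin (𝟙 M) = LinearMap.id := rfl

@[simp]
lemma comp_toLin {M N P : PhiModule φ R} (f : M ⟶ N) (g : N ⟶ P) :
    Hom.toLin (f ≫ g) = g.toLin ∘ₗ f.toLin := rfl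

@[ext]
lemma hom_ext {M N : PhiModule φ R} {f g : M ⟶ N} (h : f.toLin = g.toLin) : f = g :=
  Hom.ext h

/-- The underlying `A`-module is finite free, and some power `E ^ h`, `h > 0`, kills the cokernel of
the linearization of the Frobenius. -/
def IsFiniteHeight (E : A) : ObjectProperty (PhiModule φ R) := fun M ↦
  Module.Finite A M.carrier ∧ Module.Free A M.carrier ∧
    ∃ h : ℕ, 0 < h ∧ ∀ m : M.carrier, E ^ h • m ∈ M.lin.range

/-- The underlying `A`-module is finite free and the linearization of the Frobenius is an
isomorphism. -/
def IsFreeEtale : ObjectProperty (PhiModule φ R) := fun M ↦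
  Module.Finite A M.carrier ∧ Module.Free A M.carrier ∧ Function.Bijective M.lin

end PhiModule

end

section BaseChange

variable {Z} {A B : Type u} [CommRing A] [Algebra Z A] [CommRing B] [Algebra Z B]
  [Algebra A B] [IsScalarTower Z A B] (R : Type u) [CommRing R] [Algebra Z R]

/-- `B ⊗[Z] R` as an algebra over `A ⊗[Z] R`, for an `A`-algebra `B`. -/
instance (priority := 1) algebraTensor : Algebra (A ⊗[Z] R) (B ⊗[Z] R) :=
  (Algebra.TensorProduct.map (IsScalarTower.toAlgHom Z A B) (AlgHom.id Z R)).toRingHom.toAlgebra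

lemma algebraMap_tmul (a : A) (r : R) :
    algebraMap (A ⊗[Z] R) (B ⊗[Z] R) (a ⊗ₜ r) = algebraMap A B a ⊗ₜ r := rfl

instance : IsScalarTower A (A ⊗[Z] R) (B ⊗[Z] R) :=
  .of_algebraMap_eq' (by
    ext a
    simp [Algebra.TensorProduct.algebraMap_apply, RingHom.algebraMap_toAlgebra])

attribute [local instance] Algebra.TensorProduct.rightAlgebra in
lemma isPushout : Algebra.IsPushout A B (A ⊗[Z] R) (B ⊗[Z] R) := by
  have h1 : IsScalarTower R (A ⊗[Z] R) (B ⊗[Z] R) := .of_algebraMap_eq' (by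
    ext a
    simp [RingHom.algebraMap_toAlgebra])
  have h2 : IsScalarTower Z (A ⊗[Z] R) (B ⊗[Z] R) := .of_algebraMap_eq' (by
    ext a
    simp [Algebra.TensorProduct.algebraMap_apply, RingHom.algebraMap_toAlgebra])
  have h3 : IsScalarTower A B (B ⊗[Z] R) := inferInstance
  exact Algebra.IsPushout.comp_iff (R := Z) (S := A) (T := B) (R' := R) (S' := A ⊗[Z] R)
    (T' := B ⊗[Z] R) |>.mp inferInstance

variable {R}
variable {φ : A →ₐ[Z] A} (ψ : B →ₐ[Z] B)

lemma frobR_algebraMap (hψ : ∀ a, ψ (algebraMap A B a) = algebraMap A B (φ a)) (x : A ⊗[Z] R) : frobR ψ R (algebraMap (A ⊗[Z] R) (B ⊗[Z] R) x) =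
    algebraMap (A ⊗[Z] R) (B ⊗[Z] R) (frobR φ R x) := by
  induction x with
  | zero => simp
  | tmul a r => simp [algebraMap_tmul, hψ]
  | add x y hx hy => simp [hx, hy]

variable (hψ : ∀ a, ψ (algebraMap A B a) = algebraMap A B (φ a))

/-- `φ_B ⊗ 1` as a semilinear map over `φ_A ⊗ 1`. -/
def frobRSemilin : B ⊗[Z] R →ₛₗ[frobR φ R] B ⊗[Z] R where
  toFun := frobR ψ R
  map_add' := map_add _
  map_smul' a b := by
    rw [Algebra.smul_def, map_mul, frobR_algebraMap ψ hψ, Algebra.smul_def]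

section

variable {M N : Type u} [AddCommGroup M] [Module (A ⊗[Z] R) M]
  [AddCommGroup N] [Module (A ⊗[Z] R) N]

/-- The Frobenius `b ⊗ m ↦ φ_B(b) ⊗ φ_M(m)` on `(B ⊗ R) ⊗_{A ⊗ R} M`. -/
def frobBaseChange (f : M →ₛₗ[frobR φ R] M) :
    (B ⊗[Z] R) ⊗[A ⊗[Z] R] M →ₛₗ[frobR ψ R] (B ⊗[Z] R) ⊗[A ⊗[Z] R] M where
  toFun := TensorProduct.map (frobRSemilin ψ hψ) f
  map_add' := map_add _
  map_smul' := fun b x ↦ by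
    induction x with
    | zero => simp
    | tmul c m =>
      rw [TensorProduct.smul_tmul', TensorProduct.map_tmul, TensorProduct.map_tmul,
        TensorProduct.smul_tmul', smul_eq_mul, smul_eq_mul]
      congr 1
      exact map_mul (frobR ψ R) b c
    | add x y hx hy => rw [smul_add, map_add, hx, hy, map_add, smul_add]

@[simp]
lemma frobBaseChange_tmul (f : M →ₛₗ[frobR φ R] M) (b : B ⊗[Z] R) (m : M) :
    frobBaseChange ψ hψ f (b ⊗ₜ m) = frobR ψ R b ⊗ₜ f m := rfl

lemma frobBaseChange_natural (f : M →ₛₗ[frobR φ R] M) (g : N →ₛₗ[frobR φ R] N)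
    (h : M →ₗ[A ⊗[Z] R] N) (hh : ∀ m, h (f m) = g (h m)) (x : (B ⊗[Z] R) ⊗[A ⊗[Z] R] M) :
    h.baseChange (B ⊗[Z] R) (frobBaseChange ψ hψ f x) =
      frobBaseChange ψ hψ g (h.baseChange (B ⊗[Z] R) x) := by
  induction x with
  | zero => simp
  | tmul c m => simp [hh]
  | add x y hx hy => simp [hx, hy]

end

namespace PhiModule

/-- The scalar extension `(B ⊗ R) ⊗_{A ⊗ R} M`, with Frobenius `b ⊗ m ↦ φ_B(b) ⊗ φ_M(m)`. -/
def baseChange (M : PhiModule φ R) : PhiModule ψ R where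
  carrier := (B ⊗[Z] R) ⊗[A ⊗[Z] R] M.carrier
  frob := frobBaseChange ψ hψ M.frob

/-- Scalar extension of `φ`-modules with `R`-action as a functor. -/
def baseChangeFunctor : PhiModule φ R ⥤ PhiModule ψ R where
  obj M := M.baseChange ψ hψ
  map f :=
    { toLin := f.toLin.baseChange (B ⊗[Z] R)
      comm := frobBaseChange_natural ψ hψ _ _ f.toLin f.comm }
  map_id _ := hom_ext LinearMap.baseChange_id
  map_comp _ _ := hom_ext (LinearMap.baseChange_comp _ _)

/-- The underlying `B`-module of the scalar extension is `B ⊗[A] M`. -/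
def baseChangeEquiv (M : PhiModule φ R) :
    (M.baseChange ψ hψ).carrier ≃ₗ[B] B ⊗[A] M.carrier :=
  haveI := isPushout (Z := Z) (A := A) (B := B) R
  Algebra.IsPushout.cancelBaseChange A B (A ⊗[Z] R) (B ⊗[Z] R) M.carrier

lemma baseChangeEquiv_symm_tmul (M : PhiModule φ R) (b : B) (m : M.carrier) :
    (M.baseChangeEquiv ψ hψ).symm (b ⊗ₜ m) = b • ((1 : B ⊗[Z] R) ⊗ₜ[A ⊗[Z] R] m :
      (B ⊗[Z] R) ⊗[A ⊗[Z] R] M.carrier) := by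
  have := isPushout (Z := Z) (A := A) (B := B) R
  refine (Algebra.IsPushout.cancelBaseChange_symm_tmul A B (A ⊗[Z] R) (B ⊗[Z] R) M.carrier b m).trans
    ?_
  rw [TensorProduct.smul_tmul', Algebra.algebraMap_eq_smul_one]

lemma smul_mem_range_lin (M : PhiModule ψ R) (b : B) {m : M.carrier} (hm : m ∈ M.lin.range) :
    b • m ∈ M.lin.range := by
  obtain ⟨x, rfl⟩ := hm
  exact ⟨(FrobTwist.untwist (ψ : B →+* B)).symm b • x, linearization_smul _ _ _ _⟩

/-- The canonical map `M → (B ⊗ R) ⊗_{A ⊗ R} M`. -/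
def toBaseChange (M : PhiModule φ R) : M.carrier →ₗ[A ⊗[Z] R] (B ⊗[Z] R) ⊗[A ⊗[Z] R] M.carrier :=
  TensorProduct.mk (A ⊗[Z] R) (B ⊗[Z] R) M.carrier 1

lemma toBaseChange_smul (M : PhiModule φ R) (a : A) (m : M.carrier) :
    toBaseChange (B := B) M (a • m) = algebraMap A B a • toBaseChange (B := B) M m := by
  rw [smul_eq, map_smul, toBaseChange, TensorProduct.mk_apply,
    TensorProduct.smul_tmul', TensorProduct.smul_tmul', Algebra.smul_def, algebraMap_tmul, mul_one,
    Algebra.smul_def, mul_one]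
  rfl

lemma toBaseChange_mem (M : PhiModule φ R) {m : M.carrier} (hm : m ∈ M.lin.range) :
    (toBaseChange (B := B) M m : (M.baseChange ψ hψ).carrier) ∈
      (M.baseChange ψ hψ).lin.range := by
  obtain ⟨x, rfl⟩ := hm
  induction x with
  | zero => rw [map_zero, map_zero]; exact zero_mem _
  | tmul a m =>
    have h1 : toBaseChange (B := B) M (M.lin (a ⊗ₜ m)) =
        algebraMap A B (FrobTwist.untwist (φ : A →+* A) a) •
        frobBaseChange ψ hψ M.frob (toBaseChange (B := B) M m) := by
      change toBaseChange (B := B) M (FrobTwist.untwist (φ : A →+* A) a • M.frob m) = _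
      rw [toBaseChange_smul, toBaseChange, TensorProduct.mk_apply, TensorProduct.mk_apply,
        frobBaseChange_tmul, map_one]
    rw [h1]
    refine smul_mem_range_lin _ _ _ ⟨(1 : FrobTwist (ψ : B →+* B)) ⊗ₜ[B]
      (toBaseChange (B := B) M m : (M.baseChange ψ hψ).carrier), ?_⟩
    exact one_smul B (frobBaseChange ψ hψ M.frob (toBaseChange (B := B) M m))
  | add x y hx hy => rw [map_add, map_add]; exact add_mem hx hy

/-- If `E` becomes invertible in `B`, the scalar extension of a `φ`-module of finite `E`-height is
étale. -/
lemma isFreeEtale_baseChange {E : A} (hE : IsUnit (algebraMap A B E)) (M : PhiModule φ R)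
    (hM : IsFiniteHeight E M) : IsFreeEtale (M.baseChange ψ hψ) := by
  obtain ⟨h1, h2, h, -, hE'⟩ := hM
  have h3 : Module.Finite B (M.baseChange ψ hψ).carrier :=
    Module.Finite.equiv (M.baseChangeEquiv ψ hψ).symm
  have h4 : Module.Free B (M.baseChange ψ hψ).carrier :=
    Module.Free.of_equiv (M.baseChangeEquiv ψ hψ).symm
  refine ⟨h3, h4, linearization_bijective _ _ fun x ↦ ?_⟩
  change x ∈ (M.baseChange ψ hψ).lin.range
  rw [← (M.baseChangeEquiv ψ hψ).symm_apply_apply x]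
  generalize M.baseChangeEquiv ψ hψ x = y
  induction y with
  | zero => rw [map_zero]; exact zero_mem _
  | tmul b m =>
    rw [baseChangeEquiv_symm_tmul]
    refine smul_mem_range_lin ψ _ b ?_
    obtain ⟨v, hv⟩ := (hE.pow h).exists_left_inv
    have h5 := smul_mem_range_lin ψ _ v (toBaseChange_mem ψ hψ M (hE' m))
    have h6 : ((1 : B ⊗[Z] R) ⊗ₜ[A ⊗[Z] R] m : (B ⊗[Z] R) ⊗[A ⊗[Z] R] M.carrier) =
        v • toBaseChange (B := B) M (E ^ h • m) := by
      rw [toBaseChange_smul, map_pow]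
      have h7 := mul_smul v (algebraMap A B E ^ h) (toBaseChange (B := B) M m)
      rw [hv] at h7
      exact (one_smul B (toBaseChange (B := B) M m)).symm.trans h7
    exact (congrArg (· ∈ (M.baseChange ψ hψ).lin.range) h6).mpr h5
  | add x y hx hy => rw [map_add]; exact add_mem hx hy

end PhiModule

end BaseChange

section Main

variable (p : ℕ) [hp : Fact p.Prime] (K : Type u) [Field K] [Algebra ℚ_[p] K]
  [FiniteDimensional ℚ_[p] K] [Algebra ℤ_[p] K] [IsScalarTower ℤ_[p] ℚ_[p] K]

/-- The ring of integers `O_K` of a finite extension `K` of `ℚ_p`. -/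
abbrev RingOfIntegers (p : ℕ) [Fact p.Prime] (K : Type u) [Field K] [Algebra ℤ_[p] K] : Type u :=
  integralClosure ℤ_[p] K

instance : Module.Finite ℤ_[p] (RingOfIntegers p K) :=
  have : CharZero K := charZero_of_injective_algebraMap (algebraMap ℚ_[p] K).injective
  IsIntegralClosure.finite ℤ_[p] ℚ_[p] K (RingOfIntegers p K)

instance : CharZero (RingOfIntegers p K) :=
  have : CharZero K := charZero_of_injective_algebraMap (algebraMap ℚ_[p] K).injective
  charZero_of_injective_algebraMap (R := ℤ) (FaithfulSMul.algebraMap_injective ℤ _)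

-- `O_K` is a discrete valuation ring, so a prime element of `O_K` is the same as a uniformizer.
variable {K} (π : RingOfIntegers p K) [hπ : Fact (Prime π)]

/-- For a uniformizer `π` the residue ring `κ = O_K / π O_K` has characteristic `p`. -/
instance : CharP (Residue π) p := charP_residue p π hπ.out

instance : PerfectRing (Residue π) p := perfectRing_residue p π hπ.out

/-- The canonical ring homomorphism `W(κ) → O_K`; it induces the identity on `κ`. -/
def wittToIntegers : WittVector p (Residue π) →+* RingOfIntegers p K :=
  haveI : Fact (¬ IsUnit (p : RingOfIntegers p K)) := ⟨not_isUnit_p p π hπ.out⟩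
  haveI := isAdicComplete_p p (O := RingOfIntegers p K)
  haveI := isDomain_residue hπ.out
  wittToRing p (natCast_mem p π hπ.out)
    (tiltToResidue_bijective p (natCast_mem p π hπ.out) (exists_pow_mem p π hπ.out))

instance algebraWittIntegers : Algebra (WittVector p (Residue π)) (RingOfIntegers p K) :=
  (wittToIntegers p π).toAlgebra

lemma mk_algebraMap_witt (x : WittVector p (Residue π)) :
    Ideal.Quotient.mk (Ideal.span {π}) (algebraMap _ (RingOfIntegers p K) x) = x.coeff 0 :=
  haveI : Fact (¬ IsUnit (p : RingOfIntegers p K)) := ⟨not_isUnit_p p π hπ.out⟩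
  haveI := isAdicComplete_p p (O := RingOfIntegers p K)
  mk_wittToRing p _ _ x

/-- `E(u) ∈ W(κ)[u] ⊆ 𝔖`, the minimal polynomial of the uniformizer `π` over `W(κ)`. -/
def eisenstein : BKRing p (Residue π) :=
  ((minpoly (WittVector p (Residue π)) π : Polynomial (WittVector p (Residue π))) :
    PowerSeries (WittVector p (Residue π)))

lemma isUnit_eisenstein :
    IsUnit (algebraMap (BKRing p (Residue π)) (OE p (Residue π)) (eisenstein p π)) := by
  obtain ⟨n, hn⟩ := minpoly_mod_p p hπ.out (mk_algebraMap_witt p π)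
  refine isUnit_of_sub_mem p (Residue π) (n := n) ?_
  have h := map_dvd (Polynomial.coeToPowerSeries.ringHom (R := WittVector p (Residue π))) hn
  rw [map_sub, map_pow, map_natCast, map_natCast] at h
  simpa [eisenstein] using h

variable (R : Type u) [CommRing R] [Algebra ℤ_[p] R]

/-- `Mod^φ_{/𝔖_R}`: Breuil-Kisin modules over `𝔖 = W(κ)[[u]]` (finite free, of some height
`h > 0` with respect to `E(u)`), equipped with an action of the `ℤ_p`-algebra `R`, viewed as
modules over `𝔖_R = 𝔖 ⊗[ℤ_p] R`. -/
abbrev ModS : Type (u + 1) :=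
  (PhiModule.IsFiniteHeight (φ := phiS p (Residue π)) (R := R) (eisenstein p π)).FullSubcategory

/-- `Mod^φ_{/O_{ℰ,R}}`: étale `φ`-modules which are finite free over `O_ℰ`, equipped with an
action of the `ℤ_p`-algebra `R`, viewed as modules over `O_{ℰ,R} = O_ℰ ⊗[ℤ_p] R`. -/
abbrev ModOE : Type (u + 1) :=
  (PhiModule.IsFreeEtale (φ := phiOE p (Residue π)) (R := R)).FullSubcategory

/-- The functor `Mod^φ_{/𝔖_R} ⥤ Mod^φ_{/O_{ℰ,R}}`, `M ↦ O_{ℰ,R} ⊗_{𝔖_R} M`. -/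
def scalarExtension : ModS p π R ⥤ ModOE p π R :=
  ObjectProperty.lift _
    (ObjectProperty.ι _ ⋙ PhiModule.baseChangeFunctor (R := R) (φ := phiS p (Residue π))
      (phiOE p (Residue π)) (phiOE_algebraMap p (Residue π)))
    (fun M ↦ PhiModule.isFreeEtale_baseChange (phiOE p (Residue π))
      (phiOE_algebraMap p (Residue π)) (isUnit_eisenstein p π) M.obj M.property)

end Main

end

end BreuilKisin

/-!
Write `W = W(κ)` and let `M`, `N` be `φ`-modules over `𝔖 = W[[u]]` of finite height. The functor is
faithful because `N → O_ℰ ⊗ N` is injective. It is full once every morphism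
`f : O_ℰ ⊗ M → O_ℰ ⊗ N` maps `M` to `N`, which concerns only the underlying modules over `𝔖` and
`O_ℰ`. In terms of bases of `M` and `N` over `𝔖`, let `A` and `B` be the matrices of the two
Frobenius maps and `X` that of `f`. Then `X A = B φ(X)`, and finite height gives matrices over `𝔖`
with `A A' = E ^ h` and `B' B = E ^ h'`. Hence
* (I) `E ^ h X = B φ(X) A'`,
* (II) `E ^ h' φ(X) = B' X A`,

and the claim is that `X` has entries in `𝔖` (`mem_range_of_mul_eq_mul_phi`).

An element of `O_ℰ` is a series `∑ aᵢ uⁱ` over `i ∈ ℤ` with `aᵢ ∈ W` and `aᵢ → 0` for `i → -∞`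
(`OE.coeff`); it lies in `𝔖` if and only if `aᵢ = 0` for `i < 0` (`OE.mem_range_iff`).

*Some nonzero polynomial multiple of `X` has entries in `𝔖`.* Iterating (II) gives
`T φ^N(X) = U X V` with `U`, `V` over `𝔖` and `T` monic of degree `D ≤ p ^ N J - J`, where
`J = h' deg E` does not depend on `N` (`exists_iterate_eq`). Since `φ^N(X)` is a series in
`u ^ (p ^ N)`, the coefficient of `u ^ (p ^ N m + D)` on the left, untwisted by Frobenius, is
`aₘ + c₁ aₘ₊₁ + ⋯ + c_J aₘ₊_J` for some `cⱼ ∈ W` depending on `N` but not on `m`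
(`OE.coeff_mul_iterate_phiOE`). If `m < -J`, that index is at most `-p ^ N`, and the coefficient on
the right involves only coefficients of `X` up to that index; so it is divisible by a high power of
`p` for large `N`. As linear forms with leading coefficient `1` cannot tend to zero on a spanning
set, a fixed nonzero linear form in `J + 1` variables annihilates all `(aₘ, …, aₘ₊_J)` with
`m < -J` (`exists_ne_zero_forall_sum_mul_eq_zero`), and this is a polynomial `g ≠ 0` with `g X` over
`𝔖` (`OE.exists_polynomial_mul_mem_range`).

*The denominator is trivial.* Let `𝔡 ⊆ W[u]` be the ideal of all `g` with `g X` over `𝔖`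
(`denomIdeal`). Up to constants it is generated by a single `P ≠ 0` (`exists_dvd_C_mul`). By (I),
`E ^ h φ(P) ∈ 𝔡`; by (II) and the decomposition of `W[u]` over `φ(W[u])`, the polynomial
`E ^ h' P` is a combination of elements of `φ(𝔡)`. So `P` and `φ(P)` agree up to constants and
powers of the irreducible polynomial `E`. Comparing valuations of the highest and of the lowest
coefficients, where `p` divides `E(0) ≠ 0`, shows that no power of `E` occurs, and comparing
degrees shows that `P` is constant (`natDegree_eq_zero_of_phiPoly`). As `𝔖` is saturated in `O_ℰ`
with respect to constants, `X` has entries in `𝔖`.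
-/

namespace BreuilKisin

noncomputable section

/-! ### Integer-indexed coefficients of power series -/

section IntCoeff

variable {A : Type*} [CommRing A]

/-- The coefficient of `u ^ i` in a power series, for an integer index `i` (zero if `i < 0`). -/
def intCoeff (i : ℤ) : PowerSeries A →ₗ[A] A :=
  if 0 ≤ i then PowerSeries.coeff i.toNat else 0

lemma intCoeff_of_neg {i : ℤ} (hi : i < 0) (y : PowerSeries A) : intCoeff i y = 0 := by
  simp [intCoeff, not_le.mpr hi]

lemma intCoeff_natCast (i : ℕ) (y : PowerSeries A) :
    intCoeff (i : ℤ) y = PowerSeries.coeff i y := by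
  simp [intCoeff]

lemma intCoeff_C_mul (i : ℤ) (a : A) (y : PowerSeries A) :
    intCoeff i (PowerSeries.C a * y) = a * intCoeff i y := by
  rw [← PowerSeries.smul_eq_C_mul, map_smul, smul_eq_mul]

lemma intCoeff_X_pow_mul (i : ℤ) (m : ℕ) (y : PowerSeries A) :
    intCoeff (i + m) (PowerSeries.X ^ m * y) = intCoeff i y := by
  rcases lt_or_ge i 0 with hi | hi
  · rw [intCoeff_of_neg hi]
    rcases lt_or_ge (i + m) 0 with h | h
    · exact intCoeff_of_neg h _
    · lift i + m to ℕ using h with j hj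
      rw [intCoeff_natCast, PowerSeries.coeff_X_pow_mul', if_neg (by omega)]
  · lift i to ℕ using hi
    rw [← Nat.cast_add, intCoeff_natCast, intCoeff_natCast, PowerSeries.coeff_X_pow_mul]

lemma natCast_pow_dvd_iff_intCoeff (q n : ℕ) (y : PowerSeries A) :
    (q : PowerSeries A) ^ n ∣ y ↔ ∀ i, (q : A) ^ n ∣ intCoeff i y := by
  have hq : (q : PowerSeries A) ^ n = PowerSeries.C ((q : A) ^ n) := by simp
  rw [hq]
  constructor
  · rintro ⟨z, rfl⟩ i
    rw [intCoeff_C_mul]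
    exact dvd_mul_right _ _
  · intro h
    have h' (i : ℕ) := h i
    choose c hc using h'
    refine ⟨PowerSeries.mk c, PowerSeries.ext fun i ↦ ?_⟩
    rw [PowerSeries.coeff_C_mul, PowerSeries.coeff_mk, ← hc, intCoeff_natCast]

lemma dvd_intCoeff_mul {a : A} {i : ℤ} {y : PowerSeries A} (s : PowerSeries A)
    (h : ∀ j ≤ i, a ∣ intCoeff j y) : a ∣ intCoeff i (s * y) := by
  rcases lt_or_ge i 0 with hi | hi
  · rw [intCoeff_of_neg hi]
    exact dvd_zero _
  · lift i to ℕ using hi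
    rw [intCoeff_natCast, PowerSeries.coeff_mul]
    refine Finset.dvd_sum fun x hx ↦ dvd_mul_of_dvd_right ?_ _
    rw [← intCoeff_natCast]
    exact h _ (by have := Finset.HasAntidiagonal.mem_antidiagonal.mp hx; omega)

end IntCoeff

lemma exists_eq_algebraMap_add_pow_mul {A : Type*} [CommRing A] (q : A) (n : ℕ)
    (x : AdicCompletion (Ideal.span {q}) A) :
    ∃ (b : A) (z : AdicCompletion (Ideal.span {q}) A),
      x = algebraMap A (AdicCompletion (Ideal.span {q}) A) b +
        algebraMap A (AdicCompletion (Ideal.span {q}) A) q ^ n * z := by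
  obtain ⟨b, hb⟩ := Ideal.Quotient.mk_surjective (AdicCompletion.evalₐ (Ideal.span {q}) n x)
  have h1 : x - algebraMap A (AdicCompletion (Ideal.span {q}) A) b ∈
      (AdicCompletion.eval (Ideal.span {q}) A n).ker := by
    rw [LinearMap.mem_ker, ← AdicCompletion.factor_evalₐ_eq_eval (I := Ideal.span {q}) _ (by simp),
      map_sub, ← hb, AlgHom.commutes, Ideal.Quotient.algebraMap_eq, sub_self, map_zero]
  rw [← AdicCompletion.pow_smul_top_eq_ker_eval ⟨{_}, by rw [Finset.coe_singleton]⟩,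
    Ideal.span_singleton_pow, Submodule.ideal_span_singleton_smul] at h1
  obtain ⟨z, -, hz⟩ := h1
  refine ⟨b, z, ?_⟩
  rw [← map_pow, ← Algebra.smul_def, add_comm, ← sub_eq_iff_eq_add]
  exact hz.symm

section Coeff

variable (p : ℕ) [Fact p.Prime] {k : Type u} [CommRing k] [CharP k p]

lemma intCoeff_phiS_mul (i : ℤ) (y : BKRing p k) :
    intCoeff (p * i) (phiS p k y) = WittVector.frobenius (intCoeff i y) := by
  have hp : 0 < (p : ℤ) := by exact_mod_cast (Fact.out : p.Prime).pos
  rcases lt_or_ge i 0 with hi | hi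
  · rw [intCoeff_of_neg hi, intCoeff_of_neg (mul_neg_of_pos_of_neg hp hi), map_zero]
  · lift i to ℕ using hi
    rw [← Nat.cast_mul, intCoeff_natCast, intCoeff_natCast]
    change PowerSeries.coeff (p * i) (PowerSeries.expand p (NeZero.ne p)
      (PowerSeries.map WittVector.frobenius y)) = _
    rw [PowerSeries.coeff_expand_mul, PowerSeries.coeff_map]

lemma intCoeff_phiS_of_not_dvd {i : ℤ} (hi : ¬ (p : ℤ) ∣ i) (y : BKRing p k) :
    intCoeff i (phiS p k y) = 0 := by
  rcases lt_or_ge i 0 with h | h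
  · exact intCoeff_of_neg h _
  · lift i to ℕ using h
    rw [intCoeff_natCast]
    change PowerSeries.coeff i (PowerSeries.expand p (NeZero.ne p)
      (PowerSeries.map WittVector.frobenius y)) = _
    exact PowerSeries.coeff_expand_of_not_dvd _ _ _ (by exact_mod_cast hi)

namespace OE

/-- `𝔖[1/u]` is `p`-adically dense in `O_ℰ`. The approximation `u⁻ᵐ y` is stated without inverting
`u`, so that coefficients can be read off from the power series `y`. -/
lemma exists_approx (x : OE p k) (n : ℕ) : ∃ (m : ℕ) (y : BKRing p k) (z : OE p k),
    algebraMap (BKRing p k) (OE p k) PowerSeries.X ^ m * x =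
      algebraMap (BKRing p k) (OE p k) y + (p : OE p k) ^ n * z := by
  obtain ⟨b, (z : OE p k), h⟩ := exists_eq_algebraMap_add_pow_mul (p : BKRingInv p k) n x
  rw [map_natCast] at h
  obtain ⟨m, y, hy⟩ := IsLocalization.Away.surj (PowerSeries.X : BKRing p k) b
  refine ⟨m, y, algebraMap (BKRing p k) (OE p k) PowerSeries.X ^ m * z, ?_⟩
  have h' : x = algebraMap (BKRingInv p k) (OE p k) b + (p : OE p k) ^ n * z := h
  have hy' := congrArg (algebraMap (BKRingInv p k) (OE p k)) hy
  rw [map_mul, map_pow] at hy'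
  change _ * algebraMap (BKRing p k) (OE p k) PowerSeries.X ^ m =
    algebraMap (BKRing p k) (OE p k) y at hy'
  rw [h', ← hy']
  ring

lemma evalₐ_pow_mul (n : ℕ) (z : OE p k) :
    AdicCompletion.evalₐ (idealP p k) n ((p : OE p k) ^ n * z : OE p k) = 0 := by
  have h : AdicCompletion.evalₐ (idealP p k) n
      ((p : AdicCompletion (idealP p k) (BKRingInv p k)) ^ n) = 0 := by
    rw [map_pow, map_natCast, ← map_natCast (Ideal.Quotient.mk _), ← map_pow,
      Ideal.Quotient.eq_zero_iff_mem]
    exact Ideal.pow_mem_pow (Ideal.mem_span_singleton_self _) n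
  refine (map_mul (AdicCompletion.evalₐ (idealP p k) n) _ _).trans ?_
  exact (congrArg (· * _) h).trans (zero_mul _)

/-- `𝔖 / p ^ n` embeds into `O_ℰ / p ^ n`. -/
lemma dvd_of_algebraMap_eq {n : ℕ} {y : BKRing p k} {z : OE p k}
    (h : algebraMap (BKRing p k) (OE p k) y = (p : OE p k) ^ n * z) :
    (p : BKRing p k) ^ n ∣ y := by
  have h1 := congrArg (AdicCompletion.evalₐ (idealP p k) n) h
  have h2 := evalₐ_pow_mul p n z
  rw [h2] at h1
  have h4 : AdicCompletion.evalₐ (idealP p k) n (algebraMap (BKRingInv p k)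
      (AdicCompletion (idealP p k) (BKRingInv p k)) (algebraMap _ _ y)) = 0 := h1
  rw [AlgHom.commutes] at h4
  have h5 := Ideal.Quotient.eq_zero_iff_mem.mp h4
  rw [Ideal.span_singleton_pow, Ideal.mem_span_singleton] at h5
  obtain ⟨b, hb⟩ := h5
  obtain ⟨m, s, hs⟩ := IsLocalization.Away.surj (PowerSeries.X : BKRing p k) b
  have h6 : algebraMap (BKRing p k) (BKRingInv p k) (PowerSeries.X ^ m * y) =
      algebraMap (BKRing p k) (BKRingInv p k) ((p : BKRing p k) ^ n * s) := by
    simp only [map_mul, map_pow, map_natCast, hb, ← hs]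
    ring
  obtain ⟨⟨c, l, rfl⟩, h7⟩ := (IsLocalization.eq_iff_exists
    (Submonoid.powers (PowerSeries.X : BKRing p k)) _).mp h6
  rw [natCast_pow_dvd_iff_intCoeff]
  intro i
  rw [← intCoeff_X_pow_mul i (l + m), pow_add, mul_assoc]
  refine (natCast_pow_dvd_iff_intCoeff p n _).mp ?_ _
  exact ⟨PowerSeries.X ^ l * s, by rw [h7]; ring⟩

end OE
end Coeff

/-! ### Coefficients of elements of `O_ℰ` -/

section Coeff

variable (p : ℕ) [Fact p.Prime] {k : Type u} [CommRing k] [CharP k p] [PerfectRing k p]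

lemma witt_eq_zero_of_forall_pow_dvd {w : WittVector p k}
    (h : ∀ n, (p : WittVector p k) ^ n ∣ w) : w = 0 := by
  refine IsHausdorff.haus (I := Ideal.span {(p : WittVector p k)}) inferInstance _ fun n ↦ ?_
  rw [SModEq.zero, smul_eq_mul, Ideal.mul_top, Ideal.span_singleton_pow, Ideal.mem_span_singleton]
  exact h n

namespace OE

variable {p}

/-- Two approximations modulo `p ^ n` of the same element have congruent coefficients. -/
lemma dvd_intCoeff_sub {x : OE p k} {n m m' : ℕ} {y y' : BKRing p k} {z z' : OE p k}
    (h : algebraMap (BKRing p k) (OE p k) PowerSeries.X ^ m * x =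
      algebraMap (BKRing p k) (OE p k) y + (p : OE p k) ^ n * z)
    (h' : algebraMap (BKRing p k) (OE p k) PowerSeries.X ^ m' * x =
      algebraMap (BKRing p k) (OE p k) y' + (p : OE p k) ^ n * z') (i : ℤ) :
    (p : WittVector p k) ^ n ∣ intCoeff (i + m) y - intCoeff (i + m') y' := by
  have h1 : algebraMap (BKRing p k) (OE p k) (PowerSeries.X ^ m' * y - PowerSeries.X ^ m * y') =
      (p : OE p k) ^ n * (algebraMap (BKRing p k) (OE p k) PowerSeries.X ^ m * z' -
        algebraMap (BKRing p k) (OE p k) PowerSeries.X ^ m' * z) := by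
    simp only [map_sub, map_mul, map_pow]
    linear_combination algebraMap (BKRing p k) (OE p k) PowerSeries.X ^ m * h' -
      algebraMap (BKRing p k) (OE p k) PowerSeries.X ^ m' * h
  have h2 := (natCast_pow_dvd_iff_intCoeff p n _).mp (dvd_of_algebraMap_eq p h1) (i + m + m')
  rwa [map_sub, intCoeff_X_pow_mul, show i + m + m' = i + m' + m by ring, intCoeff_X_pow_mul] at h2

lemma exists_coeff (i : ℤ) (x : OE p k) : ∃ w : WittVector p k,
    ∀ (n m : ℕ) (y : BKRing p k) (z : OE p k),
      algebraMap (BKRing p k) (OE p k) PowerSeries.X ^ m * x =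
        algebraMap (BKRing p k) (OE p k) y + (p : OE p k) ^ n * z →
      (p : WittVector p k) ^ n ∣ w - intCoeff (i + m) y := by
  choose m y z h using exists_approx p x
  obtain ⟨w, hw⟩ := IsPrecomplete.prec' (I := Ideal.span {(p : WittVector p k)})
    (fun n ↦ intCoeff (i + m n) (y n)) (fun {n n'} hn ↦ by
      rw [SModEq.sub_mem, smul_eq_mul, Ideal.mul_top, Ideal.span_singleton_pow,
        Ideal.mem_span_singleton]
      refine dvd_intCoeff_sub (h n) (z' := (p : OE p k) ^ (n' - n) * z n') ?_ i
      rw [h n', ← mul_assoc, ← pow_add, Nat.add_sub_cancel' hn])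
  refine ⟨w, fun n m' y' z' h' ↦ ?_⟩
  have h1 := hw n
  rw [SModEq.sub_mem, smul_eq_mul, Ideal.mul_top, Ideal.span_singleton_pow,
    Ideal.mem_span_singleton] at h1
  have h2 := dvd_sub (dvd_intCoeff_sub (h n) h' i) h1
  convert h2 using 1
  ring

/-- The coefficient of `u ^ i` of an element of `O_ℰ`, viewed as a Laurent series
`∑ aᵢ uⁱ`, `i ∈ ℤ`, with coefficients `aᵢ ∈ W(k)` tending to `0` for `i → -∞`. Modulo `p ^ n`, it is
read off from any approximation modulo `p ^ n` by an element of `𝔖[1/u]`. -/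
def coeff (i : ℤ) (x : OE p k) : WittVector p k := (exists_coeff i x).choose

lemma dvd_coeff_sub {x : OE p k} {n m : ℕ} {y : BKRing p k} {z : OE p k}
    (h : algebraMap (BKRing p k) (OE p k) PowerSeries.X ^ m * x =
      algebraMap (BKRing p k) (OE p k) y + (p : OE p k) ^ n * z) (i : ℤ) :
    (p : WittVector p k) ^ n ∣ coeff i x - intCoeff (i + m) y :=
  (exists_coeff i x).choose_spec n m y z h

lemma eq_coeff {i : ℤ} {x : OE p k} {w : WittVector p k}
    (h : ∀ n, ∃ (m : ℕ) (y : BKRing p k) (z : OE p k),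
      algebraMap (BKRing p k) (OE p k) PowerSeries.X ^ m * x =
        algebraMap (BKRing p k) (OE p k) y + (p : OE p k) ^ n * z ∧
      (p : WittVector p k) ^ n ∣ w - intCoeff (i + m) y) : coeff i x = w := by
  rw [← sub_eq_zero]
  refine witt_eq_zero_of_forall_pow_dvd p fun n ↦ ?_
  obtain ⟨m, y, z, h1, h2⟩ := h n
  have h3 := dvd_sub (dvd_coeff_sub h1 i) h2
  rwa [sub_sub_sub_cancel_right] at h3

lemma coeff_add (i : ℤ) (x x' : OE p k) : coeff i (x + x') = coeff i x + coeff i x' := by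
  refine eq_coeff fun n ↦ ?_
  obtain ⟨m, y, z, h⟩ := exists_approx p x n
  obtain ⟨m', y', z', h'⟩ := exists_approx p x' n
  have h1 : algebraMap (BKRing p k) (OE p k) PowerSeries.X ^ (m' + m) * x =
      algebraMap (BKRing p k) (OE p k) (PowerSeries.X ^ m' * y) + (p : OE p k) ^ n *
        (algebraMap (BKRing p k) (OE p k) PowerSeries.X ^ m' * z) := by
    simp only [map_mul, map_pow]
    linear_combination algebraMap (BKRing p k) (OE p k) PowerSeries.X ^ m' * h
  have h2 : algebraMap (BKRing p k) (OE p k) PowerSeries.X ^ (m' + m) * x' =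
      algebraMap (BKRing p k) (OE p k) (PowerSeries.X ^ m * y') + (p : OE p k) ^ n *
        (algebraMap (BKRing p k) (OE p k) PowerSeries.X ^ m * z') := by
    simp only [map_mul, map_pow]
    linear_combination algebraMap (BKRing p k) (OE p k) PowerSeries.X ^ m * h'
  refine ⟨_, _, _, by rw [mul_add, h1, h2, add_add_add_comm, ← map_add, ← mul_add], ?_⟩
  rw [map_add, add_sub_add_comm]
  exact dvd_add (dvd_coeff_sub h1 i) (dvd_coeff_sub h2 i)

lemma coeff_C_mul (i : ℤ) (a : WittVector p k) (x : OE p k) :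
    coeff i (algebraMap (BKRing p k) (OE p k) (PowerSeries.C a) * x) = a * coeff i x := by
  refine eq_coeff fun n ↦ ?_
  obtain ⟨m, y, z, h⟩ := exists_approx p x n
  refine ⟨m, PowerSeries.C a * y, algebraMap (BKRing p k) (OE p k) (PowerSeries.C a) * z, ?_, ?_⟩
  · rw [map_mul]
    linear_combination algebraMap (BKRing p k) (OE p k) (PowerSeries.C a) * h
  · rw [intCoeff_C_mul, ← mul_sub]
    exact dvd_mul_of_dvd_right (dvd_coeff_sub h i) _

lemma coeff_X_pow_mul (i : ℤ) (l : ℕ) (x : OE p k) :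
    coeff i (algebraMap (BKRing p k) (OE p k) PowerSeries.X ^ l * x) = coeff (i - l) x := by
  refine eq_coeff fun n ↦ ?_
  obtain ⟨m, y, z, h⟩ := exists_approx p x n
  refine ⟨m, PowerSeries.X ^ l * y, algebraMap (BKRing p k) (OE p k) PowerSeries.X ^ l * z, ?_, ?_⟩
  · rw [map_mul, map_pow]
    linear_combination algebraMap (BKRing p k) (OE p k) PowerSeries.X ^ l * h
  · rw [show i + m = (i - l + m) + l by ring, intCoeff_X_pow_mul]
    exact dvd_coeff_sub h _

lemma coeff_algebraMap (i : ℤ) (y : BKRing p k) :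
    coeff i (algebraMap (BKRing p k) (OE p k) y) = intCoeff i y :=
  eq_coeff fun n ↦ ⟨0, y, 0, by ring, by simp⟩

/-- The coefficients of an element of `O_ℰ` as an additive map. -/
def coeffHom (i : ℤ) : OE p k →+ WittVector p k where
  toFun := coeff i
  map_zero' := by
    rw [← map_zero (algebraMap (BKRing p k) (OE p k)), coeff_algebraMap, map_zero]
  map_add' := coeff_add i

lemma coeff_sum {ι : Type*} (s : Finset ι) (i : ℤ) (f : ι → OE p k) :
    coeff i (∑ j ∈ s, f j) = ∑ j ∈ s, coeff i (f j) :=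
  map_sum (coeffHom i) f s

lemma coeff_zero (i : ℤ) : coeff i (0 : OE p k) = 0 := map_zero (coeffHom i)

/-- The coefficients of the product of a polynomial with an element of `O_ℰ`. -/
lemma coeff_polynomial_mul (i : ℤ) (g : Polynomial (WittVector p k)) {n : ℕ} (hn : g.natDegree < n)
    (x : OE p k) :
    coeff i (algebraMap (BKRing p k) (OE p k) (g : PowerSeries (WittVector p k)) * x) =
      ∑ j ∈ Finset.range n, g.coeff j * coeff (i - j) x := by
  have h : (g : PowerSeries (WittVector p k)) =
      ∑ j ∈ Finset.range n, PowerSeries.C (g.coeff j) * PowerSeries.X ^ j := by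
    have h1 := congrArg (Polynomial.coeToPowerSeries.ringHom (R := WittVector p k))
      (g.as_sum_range_C_mul_X_pow' hn)
    rw [map_sum] at h1
    simpa using h1
  rw [h, map_sum, Finset.sum_mul, coeff_sum]
  refine Finset.sum_congr rfl fun j _ ↦ ?_
  rw [map_mul, mul_assoc, coeff_C_mul, map_pow, coeff_X_pow_mul]

/-- The coefficients of an element of `O_ℰ` tend to `0` for `i → -∞`. -/
lemma exists_forall_dvd_coeff (x : OE p k) (n : ℕ) :
    ∃ m : ℕ, ∀ i : ℤ, i < -m → (p : WittVector p k) ^ n ∣ coeff i x := by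
  obtain ⟨m, y, z, h⟩ := exists_approx p x n
  refine ⟨m, fun i hi ↦ ?_⟩
  have h1 := dvd_coeff_sub h i
  rwa [intCoeff_of_neg (by omega), sub_zero] at h1

/-- Multiplication by `s ∈ 𝔖` does not involve coefficients of higher index. -/
lemma dvd_coeff_mul {n : ℕ} {i : ℤ} {x : OE p k} (s : BKRing p k)
    (h : ∀ j ≤ i, (p : WittVector p k) ^ n ∣ coeff j x) :
    (p : WittVector p k) ^ n ∣ coeff i (algebraMap (BKRing p k) (OE p k) s * x) := by
  obtain ⟨m, y, z, hy⟩ := exists_approx p x n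
  have h1 : algebraMap (BKRing p k) (OE p k) PowerSeries.X ^ m *
      (algebraMap (BKRing p k) (OE p k) s * x) =
      algebraMap (BKRing p k) (OE p k) (s * y) +
        (p : OE p k) ^ n * (algebraMap (BKRing p k) (OE p k) s * z) := by
    rw [map_mul]
    linear_combination algebraMap (BKRing p k) (OE p k) s * hy
  rw [dvd_iff_dvd_of_dvd_sub (dvd_coeff_sub h1 i)]
  refine dvd_intCoeff_mul s fun j hj ↦ ?_
  have h2 := dvd_coeff_sub hy (j - m)
  rw [sub_add_cancel] at h2
  exact (dvd_iff_dvd_of_dvd_sub h2).mp (h _ (by omega))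

lemma approx_phiOE {x : OE p k} {n m : ℕ} {y : BKRing p k} {z : OE p k}
    (h : algebraMap (BKRing p k) (OE p k) PowerSeries.X ^ m * x =
      algebraMap (BKRing p k) (OE p k) y + (p : OE p k) ^ n * z) :
    algebraMap (BKRing p k) (OE p k) PowerSeries.X ^ (p * m) * phiOE p k x =
      algebraMap (BKRing p k) (OE p k) (phiS p k y) + (p : OE p k) ^ n * phiOE p k z := by
  have h1 := congrArg (phiOE p k) h
  simpa only [map_mul, map_add, map_pow, map_natCast, phiOE_algebraMap, phiS_X, ← pow_mul] using h1

lemma coeff_phiOE_mul (i : ℤ) (x : OE p k) :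
    coeff (p * i) (phiOE p k x) = WittVector.frobenius (coeff i x) := by
  refine eq_coeff fun n ↦ ?_
  obtain ⟨m, y, z, h⟩ := exists_approx p x n
  refine ⟨_, _, _, approx_phiOE h, ?_⟩
  rw [Nat.cast_mul, ← mul_add, intCoeff_phiS_mul, ← map_sub]
  have := map_dvd (WittVector.frobenius (p := p) (R := k)) (dvd_coeff_sub h i)
  rwa [map_pow, map_natCast] at this

lemma coeff_phiOE_of_not_dvd {i : ℤ} (hi : ¬ (p : ℤ) ∣ i) (x : OE p k) :
    coeff i (phiOE p k x) = 0 := by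
  refine eq_coeff fun n ↦ ?_
  obtain ⟨m, y, z, h⟩ := exists_approx p x n
  refine ⟨_, _, _, approx_phiOE h, ?_⟩
  rw [intCoeff_phiS_of_not_dvd, sub_zero]
  · exact dvd_zero _
  · rwa [Nat.cast_mul, dvd_add_left (dvd_mul_right _ _)]

end OE
end Coeff

/-! ### The rationality criterion -/

section Coeff

variable {p : ℕ} [Fact p.Prime] {k : Type u} [CommRing k] [CharP k p] [PerfectRing k p]

lemma pow_dvd_of_iterate_frobenius {n : ℕ} (N : ℕ) {w : WittVector p k}
    (h : (p : WittVector p k) ^ n ∣ WittVector.frobenius^[N] w) : (p : WittVector p k) ^ n ∣ w := by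
  induction N with
  | zero => exact h
  | succ N ih =>
    rw [Function.iterate_succ_apply'] at h
    have h1 := map_dvd (WittVector.frobeniusEquiv p k).symm h
    rw [map_pow, map_natCast] at h1
    exact ih (h1.trans (dvd_of_eq ((WittVector.frobeniusEquiv p k).symm_apply_apply _)))

namespace OE

lemma eq_zero_of_forall_coeff {x : OE p k} (h : ∀ i, coeff i x = 0) : x = 0 := by
  refine AdicCompletion.ext_evalₐ fun n ↦ ?_
  obtain ⟨m, y, z, hy⟩ := exists_approx p x n
  have h1 : (p : BKRing p k) ^ n ∣ y := by
    rw [natCast_pow_dvd_iff_intCoeff]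
    intro i
    have h2 := dvd_coeff_sub hy (i - m)
    rwa [h, zero_sub, sub_add_cancel, dvd_neg] at h2
  obtain ⟨y', rfl⟩ := h1
  obtain ⟨v, hv⟩ := ((isUnit_X p k).pow m).exists_left_inv
  have h3 : x = (p : OE p k) ^ n * (v * (algebraMap (BKRing p k) (OE p k) y' + z)) := by
    rw [map_mul, map_pow, map_natCast] at hy
    linear_combination v * hy - x * hv
  rw [h3]
  exact (evalₐ_pow_mul p n _).trans (map_zero _).symm

lemma algebraMap_injective :
    Function.Injective (algebraMap (BKRing p k) (OE p k)) := by
  rw [injective_iff_map_eq_zero]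
  intro y hy
  ext i : 1
  rw [← intCoeff_natCast, ← coeff_algebraMap, hy, coeff_zero, map_zero]

/-- An element of `O_ℰ` lies in `𝔖` if and only if it has no polar part. -/
lemma mem_range_iff {x : OE p k} :
    x ∈ (algebraMap (BKRing p k) (OE p k)).range ↔ ∀ i < 0, coeff i x = 0 := by
  constructor
  · rintro ⟨y, rfl⟩ i hi
    rw [coeff_algebraMap, intCoeff_of_neg hi]
  · intro h
    refine ⟨PowerSeries.mk fun i ↦ coeff i x, ?_⟩
    rw [eq_comm, ← sub_eq_zero]
    refine eq_zero_of_forall_coeff fun i ↦ ?_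
    refine (map_sub (coeffHom (p := p) (k := k) i) _ _).trans (sub_eq_zero.mpr ?_)
    change coeff i x = coeff i _
    rw [coeff_algebraMap]
    rcases lt_or_ge i 0 with hi | hi
    · rw [h i hi, intCoeff_of_neg hi]
    · lift i to ℕ using hi
      rw [intCoeff_natCast, PowerSeries.coeff_mk]

lemma coeff_iterate_phiOE_mul (N : ℕ) (i : ℤ) (x : OE p k) :
    coeff (p ^ N * i) ((phiOE p k)^[N] x) = WittVector.frobenius^[N] (coeff i x) := by
  induction N with
  | zero => simp
  | succ N ih =>
    rw [Function.iterate_succ_apply', Function.iterate_succ_apply', pow_succ', mul_assoc,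
      coeff_phiOE_mul, ih]

lemma coeff_iterate_phiOE_of_not_dvd {N : ℕ} {i : ℤ} (hi : ¬ (p : ℤ) ^ N ∣ i) (x : OE p k) :
    coeff i ((phiOE p k)^[N] x) = 0 := by
  induction N generalizing i with
  | zero => simp at hi
  | succ N ih =>
    rw [Function.iterate_succ_apply']
    by_cases h : (p : ℤ) ∣ i
    · obtain ⟨j, rfl⟩ := h
      rw [coeff_phiOE_mul, ih, map_zero]
      rw [pow_succ'] at hi
      exact fun h' ↦ hi (mul_dvd_mul_left _ h')
    · exact coeff_phiOE_of_not_dvd h _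

/-- In the product of a polynomial of degree `D` with a series in powers of `u ^ (p ^ N)`, the
coefficient of `u ^ (p ^ N * m + D)` involves only every `p ^ N`-th coefficient of the
polynomial. -/
lemma coeff_mul_iterate_phiOE (T : Polynomial (WittVector p k)) {N J : ℕ}
    (hT : T.natDegree ≤ p ^ N * J) (m : ℤ) (x : OE p k) :
    coeff (p ^ N * m + T.natDegree)
      (algebraMap (BKRing p k) (OE p k) (T : PowerSeries (WittVector p k)) *
        (phiOE p k)^[N] x) =
    ∑ j : Fin (J + 1), (if p ^ N * (j : ℕ) ≤ T.natDegree then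
      T.coeff (T.natDegree - p ^ N * j) else 0) * WittVector.frobenius^[N] (coeff (m + j) x) := by
  have hp : 0 < p ^ N := pow_pos (Fact.out : p.Prime).pos N
  rw [coeff_polynomial_mul _ T (Nat.lt_succ_self _), ← Finset.sum_range_reflect]
  simp only [ite_mul, zero_mul]
  rw [← Finset.sum_filter]
  symm
  refine Finset.sum_of_injOn (fun j ↦ p ^ N * (j : ℕ)) ?_ ?_ ?_ ?_
  · intro a _ b _ hab
    exact Fin.ext (Nat.eq_of_mul_eq_mul_left hp hab)
  · intro j hj
    simp only [Finset.coe_filter, Finset.mem_univ, true_and, Set.mem_ofPred_eq] at hj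
    simp only [Finset.coe_range, Set.mem_Iio]
    omega
  · intro l hl hl'
    rw [Finset.mem_range] at hl
    rw [coeff_iterate_phiOE_of_not_dvd, mul_zero]
    intro hdvd
    rw [show (p : ℤ) ^ N * m + T.natDegree - ((T.natDegree.succ - 1 - l : ℕ) : ℤ) =
      p ^ N * m + l by omega, dvd_add_right (dvd_mul_right _ _)] at hdvd
    obtain ⟨j, rfl⟩ : p ^ N ∣ l := by exact_mod_cast hdvd
    refine hl' ⟨⟨j, ?_⟩, ?_, rfl⟩
    · have : p ^ N * j ≤ p ^ N * J := by omega
      exact Nat.lt_succ_of_le (Nat.le_of_mul_le_mul_left this hp)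
    · simp only [Finset.coe_filter, Finset.mem_univ, true_and, Set.mem_ofPred_eq]
      omega
  · intro j hj
    simp only [Finset.mem_filter, Finset.mem_univ, true_and] at hj
    rw [show T.natDegree.succ - 1 - p ^ N * (j : ℕ) = T.natDegree - p ^ N * j by omega,
      ← coeff_iterate_phiOE_mul]
    congr 2
    push_cast [hj]
    ring

end OE
end Coeff

/-- If a family of vectors is, modulo arbitrarily high powers of `q`, annihilated by linear forms
with leading coefficient `1`, then it is annihilated by a nonzero linear form: otherwise some
nonzero multiple of the first basis vector would be a linear combination of the family. -/
lemma exists_ne_zero_forall_sum_mul_eq_zero {A : Type*} [CommRing A] [IsDomain A] {q : A}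
    (hq : ∀ w : A, (∀ n, q ^ n ∣ w) → w = 0) {J : ℕ} {ι : Type*} (v : ι → Fin (J + 1) → A)
    (h : ∀ n, ∃ c : Fin (J + 1) → A, c 0 = 1 ∧ ∀ i, q ^ n ∣ ∑ j, c j * v i j) :
    ∃ c : Fin (J + 1) → A, c ≠ 0 ∧ ∀ i, ∑ j, c j * v i j = 0 := by
  classical
  let F := FractionRing A
  let w (i : ι) (j : Fin (J + 1)) : F := algebraMap A F (v i j)
  by_cases he : (Pi.single 0 1 : Fin (J + 1) → F) ∈ Submodule.span F (Set.range w)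
  · exfalso
    obtain ⟨f, hf⟩ := (Finsupp.mem_span_range_iff_exists_finsupp).mp he
    obtain ⟨b, hb⟩ := IsLocalization.exist_integer_multiples (nonZeroDivisors A) f.support f
    choose! g hg using hb
    have h1 (j : Fin (J + 1)) : ∑ i ∈ f.support, g i * v i j = if j = 0 then (b : A) else 0 := by
      apply IsFractionRing.injective A F
      have h2 : ∑ i ∈ f.support, f i * w i j = Pi.single (M := fun _ ↦ F) 0 1 j := by
        rw [← hf, Finsupp.sum, Finset.sum_apply]
        rfl
      have h3 := congrArg (algebraMap A F b * ·) h2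
      rw [Finset.mul_sum, Pi.single_apply] at h3
      rw [map_sum]
      refine Eq.trans (Finset.sum_congr rfl fun i hi ↦ ?_) (h3.trans ?_)
      · rw [map_mul, hg i hi, Algebra.smul_def, mul_assoc]
      · split_ifs <;> simp
    refine nonZeroDivisors.coe_ne_zero b (hq _ fun n ↦ ?_)
    obtain ⟨c, hc0, hc⟩ := h n
    have h3 : (b : A) = ∑ i ∈ f.support, g i * ∑ j, c j * v i j := by
      simp only [Finset.mul_sum]
      rw [Finset.sum_comm]
      have (j : Fin (J + 1)) : ∑ i ∈ f.support, g i * (c j * v i j) =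
          c j * if j = 0 then (b : A) else 0 := by
        rw [← h1, Finset.mul_sum]
        exact Finset.sum_congr rfl fun i _ ↦ by ring
      simp only [this, mul_ite, mul_zero, Finset.sum_ite_eq', Finset.mem_univ, if_true, hc0,
        one_mul]
    rw [h3]
    exact Finset.dvd_sum fun i _ ↦ dvd_mul_of_dvd_right (hc i) _
  · obtain ⟨f, hf0, hf⟩ := Submodule.exists_le_ker_of_notMem he
    obtain ⟨b, hb⟩ := IsLocalization.exist_integer_multiples (nonZeroDivisors A) Finset.univ
      (fun j ↦ f (Pi.single j 1))
    choose g hg using fun j ↦ hb j (Finset.mem_univ j)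
    refine ⟨g, fun h0 ↦ hf0 ?_, fun i ↦ ?_⟩
    · have h1 := hg 0
      rw [h0, Pi.zero_apply, map_zero, Algebra.smul_def, eq_comm, mul_eq_zero] at h1
      exact h1.resolve_left (IsFractionRing.to_map_ne_zero_of_mem_nonZeroDivisors b.2)
    · apply IsFractionRing.injective A F
      have h1 : f (w i) = 0 := hf (Submodule.subset_span ⟨i, rfl⟩)
      rw [LinearMap.pi_apply_eq_sum_univ] at h1
      have h2 := congrArg (algebraMap A F b * ·) h1
      simp only [mul_zero] at h2
      rw [Finset.mul_sum] at h2
      rw [map_sum, map_zero, ← h2]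
      refine Finset.sum_congr rfl fun j _ ↦ ?_
      have h3 : (Pi.single j 1 : Fin (J + 1) → F) = fun i ↦ if j = i then 1 else 0 := by
        ext i
        simp only [Pi.single_apply, eq_comm]
      rw [map_mul, hg, Algebra.smul_def, h3, smul_eq_mul]
      ring

section

variable {p : ℕ} [Fact p.Prime] {k : Type u} [CommRing k] [IsDomain k] [CharP k p]
  [PerfectRing k p]

/-- A rationality criterion: suppose that for every `N` there is a monic polynomial `T` of degree at
most `p ^ N J - J` such that the coefficients of `T φ^N(xₐ)` are as divisible by `p` as those of the
`xₐ` of at most the same index. Then the `xₐ` have a common nonzero polynomial denominator. -/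
lemma OE.exists_polynomial_mul_mem_range {ι : Type*} [Finite ι] (x : ι → OE p k) (J : ℕ)
    (h : ∀ N, ∃ T : Polynomial (WittVector p k), T.Monic ∧ T.natDegree + J ≤ p ^ N * J ∧
      ∀ (n : ℕ) (i : ℤ), (∀ a, ∀ j ≤ i, (p : WittVector p k) ^ n ∣ coeff j (x a)) →
        ∀ a, (p : WittVector p k) ^ n ∣ coeff i
          (algebraMap (BKRing p k) (OE p k) (T : PowerSeries (WittVector p k)) *
            (phiOE p k)^[N] (x a))) :
    ∃ g : Polynomial (WittVector p k), g ≠ 0 ∧ ∀ a,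
      algebraMap (BKRing p k) (OE p k) (g : PowerSeries (WittVector p k)) * x a ∈
        (algebraMap (BKRing p k) (OE p k)).range := by
  have hp : p.Prime := Fact.out
  obtain ⟨c, hc0, hc⟩ := exists_ne_zero_forall_sum_mul_eq_zero
    (fun w hw ↦ witt_eq_zero_of_forall_pow_dvd p hw) (J := J)
    (fun (i : ι × {m : ℤ // m < -J}) j ↦ coeff (i.2.1 + j) (x i.1)) (by
      intro n
      -- below index `-N`, and hence below `-p ^ N`, all coefficients are divisible by `p ^ n`
      choose n₀ hn₀ using fun a ↦ exists_forall_dvd_coeff (x a) n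
      obtain ⟨N, hN⟩ := Finite.exists_le n₀
      obtain ⟨T, hT, hdeg, hTx⟩ := h N
      -- the coefficients of `T` whose indices are congruent to its degree modulo `p ^ N`
      refine ⟨fun j ↦ (WittVector.frobeniusEquiv p k).symm^[N]
        (if p ^ N * (j : ℕ) ≤ T.natDegree then T.coeff (T.natDegree - p ^ N * j) else 0), ?_, ?_⟩
      · simp [hT.coeff_natDegree]
      · rintro ⟨a, m, hm⟩
        have h1 := coeff_mul_iterate_phiOE T (N := N) (J := J) (by omega) m (x a)
        have h2 := hTx n (p ^ N * m + T.natDegree) (fun a j hj ↦ hn₀ a j (by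
          have h3 : N < p ^ N := Nat.lt_pow_self hp.one_lt
          have h4 : (p : ℤ) ^ N * m ≤ p ^ N * (-J - 1) := by gcongr; omega
          have h5 := hN a
          zify at hdeg h3 h5
          linarith)) a
        rw [h1] at h2
        refine pow_dvd_of_iterate_frobenius N ?_
        rw [← RingHom.coe_pow, map_sum, RingHom.coe_pow]
        refine (h2.trans <| dvd_of_eq (Finset.sum_congr rfl fun j _ ↦ ?_))
        rw [← RingHom.coe_pow, map_mul, RingHom.coe_pow]
        congr 1
        exact (Function.LeftInverse.iterate (g := WittVector.frobenius)
          (fun w ↦ (WittVector.frobeniusEquiv p k).apply_symm_apply w) N _).symm)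
  refine ⟨∑ j : Fin (J + 1), Polynomial.C (c j) * Polynomial.X ^ (J - j : ℕ), ?_, fun a ↦ ?_⟩
  · intro h0
    refine hc0 (funext fun j ↦ ?_)
    have h1 := congrArg (Polynomial.coeff · (J - j : ℕ)) h0
    simp only [Polynomial.finsetSum_coeff, Polynomial.coeff_C_mul_X_pow,
      Polynomial.coeff_zero] at h1
    rw [Finset.sum_eq_single j] at h1
    · simpa using h1
    · intro b _ hb
      rw [if_neg]
      omega
    · simp
  · rw [mem_range_iff]
    intro i hi
    have h1 := map_sum (Polynomial.coeToPowerSeries.ringHom (R := WittVector p k))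
      (fun j : Fin (J + 1) ↦ Polynomial.C (c j) * Polynomial.X ^ (J - j : ℕ)) Finset.univ
    simp only [Polynomial.coeToPowerSeries.ringHom_apply] at h1
    rw [h1, map_sum, Finset.sum_mul, coeff_sum, ← hc ⟨a, i - J, by omega⟩]
    refine Finset.sum_congr rfl fun j _ ↦ ?_
    simp only [Polynomial.coe_mul, Polynomial.coe_C, Polynomial.coe_pow, Polynomial.coe_X]
    rw [map_mul, mul_assoc, coeff_C_mul, map_pow, coeff_X_pow_mul]
    congr 2
    omega

end

/-! ### Polynomials dividing their Frobenius twist -/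

/-- Over a domain, a nonzero ideal of polynomials is generated, up to constants, by one of its
elements: the ideal it generates over the fraction field is principal. -/
lemma exists_dvd_C_mul {A : Type*} [CommRing A] [IsDomain A] (I : Ideal (Polynomial A))
    (hI : I ≠ ⊥) : ∃ P ∈ I, P ≠ 0 ∧ ∀ g ∈ I, ∃ c : A, c ≠ 0 ∧ P ∣ Polynomial.C c * g := by
  let F := FractionRing A
  let ι := Polynomial.mapRingHom (algebraMap A F)
  have hι : Function.Injective ι := Polynomial.map_injective _ (IsFractionRing.injective A F)
  -- every polynomial over the fraction field has a nonzero multiple with coefficients in `A`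
  have hden (Q : Polynomial F) : ∃ (c : A) (Q' : Polynomial A), c ≠ 0 ∧
      Polynomial.C (algebraMap A F c) * Q = ι Q' := by
    obtain ⟨b, hbA, hb⟩ := IsLocalization.integerNormalization_spec (nonZeroDivisors A) Q
    refine ⟨b, IsLocalization.integerNormalization (nonZeroDivisors A) Q,
      nonZeroDivisors.ne_zero hbA, ?_⟩
    rw [Polynomial.coe_mapRingHom, hb, ← Polynomial.smul_eq_C_mul, algebraMap_smul]
  obtain ⟨Q, hQ⟩ := (inferInstance : (I.map ι).IsPrincipal)
  have hQ' : Q ∈ I.map ι := by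
    rw [hQ]
    exact Submodule.mem_span_singleton_self Q
  have hmem (x : Polynomial F) (hx : x ∈ I.map ι) :
      ∃ (c : A) (g : Polynomial A), c ≠ 0 ∧ g ∈ I ∧ Polynomial.C (algebraMap A F c) * x = ι g := by
    induction hx using Submodule.span_induction with
    | mem x hx =>
      obtain ⟨g, hg, rfl⟩ := hx
      exact ⟨1, g, one_ne_zero, hg, by simp⟩
    | zero => exact ⟨1, 0, one_ne_zero, zero_mem _, by simp⟩
    | add x y _ _ hx hy =>
      obtain ⟨c, g, hc, hg, h⟩ := hx
      obtain ⟨c', g', hc', hg', h'⟩ := hy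
      refine ⟨c * c', Polynomial.C c' * g + Polynomial.C c * g', mul_ne_zero hc hc',
        add_mem (I.mul_mem_left _ hg) (I.mul_mem_left _ hg'), ?_⟩
      simp only [map_add, map_mul, ← h, ← h', ι, Polynomial.coe_mapRingHom, Polynomial.map_C]
      ring
    | smul a x _ hx =>
      obtain ⟨c, g, hc, hg, h⟩ := hx
      obtain ⟨c', g', hc', h'⟩ := hden a
      refine ⟨c * c', g' * g, mul_ne_zero hc hc', I.mul_mem_left _ hg, ?_⟩
      simp only [map_mul, ← h, ← h', smul_eq_mul]
      ring
  obtain ⟨c, P, hc, hP, h⟩ := hmem Q hQ'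
  have hc' : algebraMap A F c ≠ 0 := (map_ne_zero_iff _ (IsFractionRing.injective A F)).mpr hc
  have hdvd (g : Polynomial A) (hg : g ∈ I) : ∃ c : A, c ≠ 0 ∧ P ∣ Polynomial.C c * g := by
    have h1 : ι g ∈ I.map ι := Ideal.mem_map_of_mem _ hg
    rw [hQ] at h1
    obtain ⟨a, ha⟩ := Ideal.mem_span_singleton.mp h1
    obtain ⟨b, a', hb, hba⟩ := hden a
    refine ⟨b * c, mul_ne_zero hb hc, a', hι ?_⟩
    simp only [map_mul, ← h, ← hba, ha, ι, Polynomial.coe_mapRingHom, Polynomial.map_C]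
    ring
  refine ⟨P, hP, ?_, hdvd⟩
  rintro rfl
  refine hI ((Submodule.eq_bot_iff _).mpr fun g hg ↦ ?_)
  obtain ⟨b, hb, hbg⟩ := hdvd g hg
  exact (mul_eq_zero.mp (zero_dvd_iff.mp hbg)).resolve_left (Polynomial.C_ne_zero.mpr hb)

section

variable {p : ℕ} [Fact p.Prime] {k : Type u} [CommRing k] [IsDomain k] [CharP k p]
  [PerfectRing k p]

lemma prime_natCast_witt : Prime (p : WittVector p k) := by
  have h (x : WittVector p k) : (p : WittVector p k) ∣ x ↔ x.coeff 0 = 0 := by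
    rw [← Ideal.mem_span_singleton, WittVector.mem_span_p_iff_coeff_zero_eq_zero]
  refine ⟨WittVector.p_nonzero p k, fun hu ↦ ?_, fun a b hab ↦ ?_⟩
  · have h1 := (h 1).mp (hu.dvd)
    simp at h1
  · rw [h] at hab ⊢
    rw [h]
    exact mul_eq_zero.mp ((WittVector.mul_coeff_zero a b).symm.trans hab)

lemma finiteMultiplicity_witt {w : WittVector p k} (hw : w ≠ 0) :
    FiniteMultiplicity (p : WittVector p k) w := by
  by_contra h
  exact hw (witt_eq_zero_of_forall_pow_dvd p (FiniteMultiplicity.not_iff_forall.mp h))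

lemma frobenius_witt_injective : Function.Injective (WittVector.frobenius (p := p) (R := k)) :=
  (WittVector.frobeniusEquiv p k).injective

lemma multiplicity_frobenius (w : WittVector p k) :
    multiplicity (p : WittVector p k) (WittVector.frobenius w) =
      multiplicity (p : WittVector p k) w := by
  have h := multiplicity_map_eq (WittVector.frobeniusEquiv p k) (a := (p : WittVector p k)) (b := w)
  rwa [map_natCast] at h

variable (p k) in
/-- The endomorphism `φ` on polynomials: `∑ aᵢ uⁱ ↦ ∑ F(aᵢ) u^{pi}`. -/
def phiPoly : Polynomial (WittVector p k) →+* Polynomial (WittVector p k) :=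
  (Polynomial.expand (WittVector p k) p).toRingHom.comp (Polynomial.mapRingHom WittVector.frobenius)

lemma phiPoly_apply (g : Polynomial (WittVector p k)) :
    phiPoly p k g = Polynomial.expand (WittVector p k) p (g.map WittVector.frobenius) := rfl

lemma phiPoly_C (a : WittVector p k) :
    phiPoly p k (Polynomial.C a) = Polynomial.C (WittVector.frobenius a) := by
  simp [phiPoly_apply]

lemma phiPoly_X : phiPoly p k Polynomial.X = Polynomial.X ^ p := by
  simp [phiPoly_apply]

lemma coe_phiPoly (g : Polynomial (WittVector p k)) :
    (phiPoly p k g : PowerSeries (WittVector p k)) = phiS p k (g : PowerSeries _) := by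
  have h : (Polynomial.coeToPowerSeries.ringHom (R := WittVector p k)).comp (phiPoly p k) =
      (phiS p k).toRingHom.comp (Polynomial.coeToPowerSeries.ringHom (R := WittVector p k)) := by
    refine Polynomial.ringHom_ext (fun a ↦ ?_) ?_
    · simp [phiPoly_C, phiS_C]
    · simp [phiPoly_X, phiS_X]
  exact congrArg (· g) (congrArg DFunLike.coe h)

lemma natDegree_phiPoly (g : Polynomial (WittVector p k)) :
    (phiPoly p k g).natDegree = g.natDegree * p := by
  rw [phiPoly_apply, Polynomial.natDegree_expand,
    Polynomial.natDegree_map_eq_of_injective frobenius_witt_injective]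

lemma leadingCoeff_phiPoly (g : Polynomial (WittVector p k)) :
    (phiPoly p k g).leadingCoeff = WittVector.frobenius g.leadingCoeff := by
  rw [phiPoly_apply, Polynomial.leadingCoeff_expand (Fact.out : p.Prime).pos,
    Polynomial.leadingCoeff_map_of_injective frobenius_witt_injective]

lemma phiPoly_injective : Function.Injective (phiPoly p k) :=
  (Polynomial.expand_injective (Fact.out : p.Prime).pos).comp
    (Polynomial.map_injective _ frobenius_witt_injective)

lemma trailingCoeff_phiPoly {g : Polynomial (WittVector p k)} (hg : g ≠ 0) :
    (phiPoly p k g).trailingCoeff = WittVector.frobenius g.trailingCoeff := by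
  have hp : 0 < p := (Fact.out : p.Prime).pos
  have h1 : (phiPoly p k g).coeff (g.natTrailingDegree * p) =
      WittVector.frobenius g.trailingCoeff := by
    rw [phiPoly_apply, Polynomial.coeff_expand_mul hp, Polynomial.coeff_map]
    rfl
  have h2 : WittVector.frobenius g.trailingCoeff ≠ 0 :=
    (map_ne_zero_iff _ frobenius_witt_injective).mpr
      (Polynomial.trailingCoeff_nonzero_iff_nonzero.mpr hg)
  have h3 : (phiPoly p k g).natTrailingDegree = g.natTrailingDegree * p := by
    refine le_antisymm (Polynomial.natTrailingDegree_le_of_ne_zero (h1 ▸ h2)) ?_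
    refine Polynomial.le_natTrailingDegree ((map_ne_zero_iff _ phiPoly_injective).mpr hg)
      fun m hm ↦ ?_
    rw [phiPoly_apply, Polynomial.coeff_expand hp]
    split_ifs with h
    · rw [Polynomial.coeff_map, Polynomial.coeff_eq_zero_of_lt_natTrailingDegree, map_zero]
      exact (Nat.div_lt_iff_lt_mul hp).mpr hm
    · rfl
  rw [Polynomial.trailingCoeff, h3, h1]

/-- `W(k)[u]` is generated by `1, u, …, u ^ (p - 1)` over the image of `φ`. -/
lemma exists_eq_sum_X_pow_mul_phiPoly (g : Polynomial (WittVector p k)) :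
    ∃ f : Fin p → Polynomial (WittVector p k),
      g = ∑ r : Fin p, Polynomial.X ^ (r : ℕ) * phiPoly p k (f r) := by
  have hp : 0 < p := (Fact.out : p.Prime).pos
  induction g using Polynomial.induction_on' with
  | add g g' hg hg' =>
    obtain ⟨f, rfl⟩ := hg
    obtain ⟨f', rfl⟩ := hg'
    exact ⟨f + f', by simp only [Pi.add_apply, map_add, mul_add, Finset.sum_add_distrib]⟩
  | monomial n a =>
    refine ⟨Pi.single ⟨n % p, Nat.mod_lt n hp⟩ (Polynomial.C
      ((WittVector.frobeniusEquiv p k).symm a) * Polynomial.X ^ (n / p)), ?_⟩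
    rw [Finset.sum_eq_single ⟨n % p, Nat.mod_lt n hp⟩]
    · have h : WittVector.frobenius ((WittVector.frobeniusEquiv p k).symm a) = a :=
        (WittVector.frobeniusEquiv p k).apply_symm_apply a
      rw [Pi.single_eq_same, map_mul, map_pow, phiPoly_C, phiPoly_X, h, ← pow_mul, mul_left_comm,
        ← pow_add, Nat.mod_add_div, Polynomial.C_mul_X_pow_eq_monomial]
    · intro r _ hr
      rw [Pi.single_eq_of_ne hr, map_zero, mul_zero]
    · simp

/-- If `P` and `φ(P)` divide each other up to constants and powers of the irreducible Eisenstein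
polynomial `E`, then `P` is constant. Indeed `c E ^ h φ(P) = κ E ^ i P` for constants `c` and `κ`.
As `φ` preserves the valuations of the leading and of the lowest coefficient, the former show
that `c` and `κ` have the same valuation, and the latter that `h = i`, since `p ∣ E(0) ≠ 0`. So the
degree of `φ(P)`, which is `p` times that of `P`, equals the degree of `P`. -/
lemma natDegree_eq_zero_of_phiPoly {E P : Polynomial (WittVector p k)} (hE : Prime E)
    (hmonic : E.Monic) (hE0 : E.coeff 0 ≠ 0) (hpE : (p : WittVector p k) ∣ E.coeff 0)
    (hP : P ≠ 0) {h h' : ℕ} {c c' : WittVector p k} (hc : c ≠ 0) (hc' : c' ≠ 0)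
    (h1 : P ∣ Polynomial.C c * (E ^ h * phiPoly p k P))
    (h2 : phiPoly p k P ∣ Polynomial.C c' * (E ^ h' * P)) : P.natDegree = 0 := by
  obtain ⟨q, hq⟩ := h1
  obtain ⟨q', hq'⟩ := h2
  have hφP : phiPoly p k P ≠ 0 := (map_ne_zero_iff _ phiPoly_injective).mpr hP
  have hqq : q * q' = Polynomial.C (c * c') * E ^ (h + h') := by
    refine mul_left_cancel₀ (mul_ne_zero hP hφP) ?_
    calc P * phiPoly p k P * (q * q') = (P * q) * (phiPoly p k P * q') := by ring
      _ = _ := by rw [← hq, ← hq', Polynomial.C_mul]; ring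
  -- by unique factorization at `E`, the quotient `q` is a constant times a power of `E`
  obtain ⟨i, j, b, b', -, hb, rfl, -⟩ := mul_eq_mul_prime_pow hE hqq
  have hcc : Polynomial.C (c * c') ≠ 0 := Polynomial.C_ne_zero.mpr (mul_ne_zero hc hc')
  have hb0 : b ≠ 0 := fun h0 ↦ hcc (by rw [hb, h0, zero_mul])
  have hb'0 : b' ≠ 0 := fun h0 ↦ hcc (by rw [hb, h0, mul_zero])
  have hbdeg : b.natDegree = 0 := by
    have := congrArg Polynomial.natDegree hb
    rw [Polynomial.natDegree_C, Polynomial.natDegree_mul hb0 hb'0] at this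
    omega
  obtain ⟨κ, rfl⟩ : ∃ κ, b = Polynomial.C κ := ⟨_, Polynomial.eq_C_of_natDegree_eq_zero hbdeg⟩
  have hκ : κ ≠ 0 := Polynomial.C_ne_zero.mp hb0
  have hEt : E.trailingCoeff = E.coeff 0 := Polynomial.trailingCoeff_eq_coeff_zero hE0
  have hCt (a : WittVector p k) : (Polynomial.C a).trailingCoeff = a := by
    rw [Polynomial.trailingCoeff, Polynomial.natTrailingDegree_C, Polynomial.coeff_C_zero]
  have hEpt (n : ℕ) : (E ^ n).trailingCoeff = E.coeff 0 ^ n := by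
    induction n with
    | zero => rw [pow_zero, pow_zero, ← Polynomial.C_1, hCt]
    | succ n ih => rw [pow_succ, pow_succ, Polynomial.trailingCoeff_mul, ih, hEt]
  -- compare leading coefficients
  have hl := congrArg Polynomial.leadingCoeff hq
  simp only [Polynomial.leadingCoeff_mul, Polynomial.leadingCoeff_C, Polynomial.leadingCoeff_pow,
    hmonic.leadingCoeff, one_pow, one_mul, mul_one, leadingCoeff_phiPoly] at hl
  -- compare lowest coefficients
  have ht := congrArg Polynomial.trailingCoeff hq
  simp only [Polynomial.trailingCoeff_mul, hCt, hEpt, trailingCoeff_phiPoly hP] at ht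
  have hmul {x y : WittVector p k} (hx : x ≠ 0) (hy : y ≠ 0) :
      multiplicity (p : WittVector p k) (x * y) =
        multiplicity (p : WittVector p k) x + multiplicity (p : WittVector p k) y :=
    multiplicity_mul prime_natCast_witt (finiteMultiplicity_witt (mul_ne_zero hx hy))
  have hpow (n : ℕ) : multiplicity (p : WittVector p k) (E.coeff 0 ^ n) =
      n * multiplicity (p : WittVector p k) (E.coeff 0) :=
    FiniteMultiplicity.multiplicity_pow prime_natCast_witt (finiteMultiplicity_witt hE0)
  have hF {x : WittVector p k} (hx : x ≠ 0) : WittVector.frobenius x ≠ 0 :=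
    (map_ne_zero_iff _ frobenius_witt_injective).mpr hx
  have hPl : P.leadingCoeff ≠ 0 := Polynomial.leadingCoeff_ne_zero.mpr hP
  have hPt : P.trailingCoeff ≠ 0 := Polynomial.trailingCoeff_nonzero_iff_nonzero.mpr hP
  have hl' := congrArg (multiplicity (p : WittVector p k)) hl
  rw [hmul hc (hF hPl), hmul hPl hκ, multiplicity_frobenius] at hl'
  have ht' := congrArg (multiplicity (p : WittVector p k)) ht
  rw [hmul hc (mul_ne_zero (pow_ne_zero _ hE0) (hF hPt)), hmul (pow_ne_zero _ hE0) (hF hPt),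
    hmul hPt (mul_ne_zero hκ (pow_ne_zero _ hE0)), hmul hκ (pow_ne_zero _ hE0),
    multiplicity_frobenius, hpow, hpow] at ht'
  have hpos : 0 < multiplicity (p : WittVector p k) (E.coeff 0) :=
    Nat.pos_of_ne_zero fun h0 ↦ multiplicity_eq_zero.mp h0 hpE
  have hih : h = i := Nat.eq_of_mul_eq_mul_right hpos (by omega)
  subst hih
  have hd := congrArg Polynomial.natDegree hq
  rw [Polynomial.natDegree_C_mul hc, Polynomial.natDegree_mul (pow_ne_zero _ hE.ne_zero) hφP,
    Polynomial.natDegree_mul hP (mul_ne_zero hb0 (pow_ne_zero _ hE.ne_zero)),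
    Polynomial.natDegree_C_mul hκ, natDegree_phiPoly] at hd
  have h3 : P.natDegree * p = P.natDegree := by omega
  have h4 : 2 ≤ p := (Fact.out : p.Prime).two_le
  nlinarith

end

/-! ### Matrices intertwining two modules of finite height -/

section

variable {p : ℕ} [Fact p.Prime] {k : Type u} [CommRing k] [IsDomain k] [CharP k p]
  [PerfectRing k p]

/-- The `𝔖`-submodule of `O_ℰ` of all elements whose coefficients up to index `i` are divisible by
`p ^ n`. -/
def OE.coeffSubmodule (p : ℕ) [Fact p.Prime] (k : Type u) [CommRing k] [CharP k p]
    [PerfectRing k p] (n : ℕ) (i : ℤ) : Submodule (BKRing p k) (OE p k) where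
  carrier := {x | ∀ j ≤ i, (p : WittVector p k) ^ n ∣ OE.coeff j x}
  zero_mem' j _ := by simp [OE.coeff_zero]
  add_mem' hx hy j hj := by
    rw [OE.coeff_add]
    exact dvd_add (hx j hj) (hy j hj)
  smul_mem' s x hx j hj := by
    rw [Algebra.smul_def]
    exact OE.dvd_coeff_mul s fun j' hj' ↦ hx j' (hj'.trans hj)

lemma matrix_mul_mul_mem {S B : Type*} [CommRing S] [CommRing B] [Algebra S B]
    {l m n o : Type*} [Fintype m] [Fintype n] (L : Submodule S B) (U : Matrix l m S)
    (X : Matrix m n B) (V : Matrix n o S) (hX : ∀ a b, X a b ∈ L) (a : l) (b : o) :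
    (U.map (algebraMap S B) * X * V.map (algebraMap S B)) a b ∈ L := by
  rw [Matrix.mul_apply]
  refine sum_mem fun j _ ↦ ?_
  rw [Matrix.map_apply, mul_comm, ← Algebra.smul_def, Matrix.mul_apply]
  refine L.smul_mem _ (sum_mem fun i _ ↦ ?_)
  rw [Matrix.map_apply, ← Algebra.smul_def]
  exact L.smul_mem _ (hX _ _)

lemma map_smul_one {S B l : Type*} [CommRing S] [CommRing B] [DecidableEq l] (f : S →+* B) (s : S) :
    (s • (1 : Matrix l l S)).map f = f s • (1 : Matrix l l B) := by
  ext i j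
  simp [Matrix.one_apply, apply_ite f]

lemma map_phiOE_map_algebraMap {l m : Type*} (M : Matrix l m (BKRing p k)) :
    (M.map (algebraMap (BKRing p k) (OE p k))).map (phiOE p k : OE p k →+* OE p k) =
      (M.map (phiS p k)).map (algebraMap (BKRing p k) (OE p k)) := by
  ext i j
  exact phiOE_algebraMap p k _

variable {m n : Type*} [Fintype m] [Fintype n] [DecidableEq m] [DecidableEq n]

/-- Iterating the relation `E ^ h φ(X) = B X A` gives `T φ^N(X) = U X V` with
`T = E ^ h φ(E ^ h) ⋯ φ^(N-1)(E ^ h)`. -/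
lemma exists_iterate_eq (E : Polynomial (WittVector p k)) (hE : E.Monic) (h : ℕ)
    (X : Matrix m n (OE p k)) (A : Matrix n n (BKRing p k)) (B : Matrix m m (BKRing p k))
    (hX : ∀ a b, algebraMap (BKRing p k) (OE p k) (E : PowerSeries (WittVector p k)) ^ h *
      phiOE p k (X a b) = (B.map (algebraMap (BKRing p k) (OE p k)) * X *
        A.map (algebraMap (BKRing p k) (OE p k))) a b) (N : ℕ) :
    ∃ T : Polynomial (WittVector p k), T.Monic ∧
      T.natDegree + E.natDegree * h ≤ p ^ N * (E.natDegree * h) ∧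
      ∃ (U : Matrix m m (BKRing p k)) (V : Matrix n n (BKRing p k)), ∀ a b,
        algebraMap (BKRing p k) (OE p k) (T : PowerSeries (WittVector p k)) *
          (phiOE p k)^[N] (X a b) = (U.map (algebraMap (BKRing p k) (OE p k)) * X *
            V.map (algebraMap (BKRing p k) (OE p k))) a b := by
  let ι := algebraMap (BKRing p k) (OE p k)
  let Φ : OE p k →+* OE p k := phiOE p k
  induction N with
  | zero => exact ⟨1, Polynomial.monic_one, by simp, 1, 1, fun a b ↦ by simp [Matrix.map_one]⟩
  | succ N ih =>
    obtain ⟨T, hT, hdeg, U, V, hUV⟩ := ih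
    have hTm : (phiPoly p k T).Monic := by
      rw [Polynomial.Monic, leadingCoeff_phiPoly, hT.leadingCoeff, map_one]
    refine ⟨E ^ h * phiPoly p k T, (hE.pow h).mul hTm, ?_, U.map (phiS p k) * B,
      A * V.map (phiS p k), fun a b ↦ ?_⟩
    · rw [(hE.pow h).natDegree_mul hTm, hE.natDegree_pow, natDegree_phiPoly, pow_succ]
      have h2 : 2 ≤ p := (Fact.out : p.Prime).two_le
      calc h * E.natDegree + T.natDegree * p + E.natDegree * h
          = T.natDegree * p + 2 * (E.natDegree * h) := by ring
        _ ≤ T.natDegree * p + p * (E.natDegree * h) := by gcongr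
        _ = p * (T.natDegree + E.natDegree * h) := by ring
        _ ≤ p * (p ^ N * (E.natDegree * h)) := by gcongr
        _ = p ^ N * p * (E.natDegree * h) := by ring
    · have h1 : (X.map Φ).map (ι (E : PowerSeries (WittVector p k)) ^ h * ·) =
          B.map ι * X * A.map ι := by
        ext a b
        exact hX a b
      have h2 : ι (phiS p k (T : PowerSeries (WittVector p k))) * Φ ((phiOE p k)^[N] (X a b)) =
          ((U.map (phiS p k)).map ι * X.map Φ * (V.map (phiS p k)).map ι) a b := by
        have h3 := congrArg Φ (hUV a b)
        rw [map_mul, ← Matrix.map_apply (f := Φ) (M := _ * _), Matrix.map_mul, Matrix.map_mul] at h3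
        refine Eq.trans (congrArg (· * _) (phiOE_algebraMap p k _).symm) (h3.trans ?_)
        rw [map_phiOE_map_algebraMap, map_phiOE_map_algebraMap]
      rw [Function.iterate_succ_apply', Polynomial.coe_mul, Polynomial.coe_pow, coe_phiPoly,
        map_mul, map_pow, mul_assoc]
      refine (congrArg (_ * ·) h2).trans ?_
      rw [Matrix.map_mul, Matrix.map_mul]
      have h3 : (U.map (phiS p k)).map ι * B.map ι * X * (A.map ι * (V.map (phiS p k)).map ι) =
          (U.map (phiS p k)).map ι * (B.map ι * X * A.map ι) * (V.map (phiS p k)).map ι := by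
        simp only [Matrix.mul_assoc]
      refine Eq.trans ?_ (congrFun₂ h3 a b).symm
      rw [← h1]
      simp only [Matrix.mul_apply, Matrix.map_apply, Finset.mul_sum, Finset.sum_mul]
      exact Finset.sum_congr rfl fun _ _ ↦ Finset.sum_congr rfl fun _ _ ↦ by ring

/-- If `∑ u ^ r φ(yᵣ)`, `0 ≤ r < p`, has no polar part, then neither has any `yᵣ`: the summands
involve different residue classes of indices modulo `p`. -/
lemma OE.coeff_eq_zero_of_sum_X_pow_mul_phiOE (y : Fin p → OE p k)
    (h : ∀ i < 0, coeff i (∑ r : Fin p, algebraMap (BKRing p k) (OE p k) PowerSeries.X ^ (r : ℕ) *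
      phiOE p k (y r)) = 0) (r : Fin p) (i : ℤ) (hi : i < 0) : coeff i (y r) = 0 := by
  have hr := r.2
  have hp : (0 : ℤ) < p := by omega
  have h1 := h (p * i + r) (by nlinarith)
  rw [coeff_sum, Finset.sum_eq_single r, coeff_X_pow_mul, add_sub_cancel_right,
    coeff_phiOE_mul] at h1
  · exact (map_eq_zero_iff _ frobenius_witt_injective).mp h1
  · intro s _ hs
    rw [coeff_X_pow_mul]
    refine coeff_phiOE_of_not_dvd (fun hdvd ↦ hs ?_) _
    rw [add_sub_assoc, dvd_add_right (dvd_mul_right _ _)] at hdvd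
    have hs' := s.2
    have h2 := Int.eq_zero_of_abs_lt_dvd hdvd (by rw [abs_lt]; omega)
    exact Fin.ext (by omega)
  · simp

/-- The ideal of all polynomials `g` such that `g X` has entries in `𝔖`. -/
def denomIdeal (X : Matrix m n (OE p k)) : Ideal (Polynomial (WittVector p k)) where
  carrier := {g | ∀ a b, algebraMap (BKRing p k) (OE p k) (g : PowerSeries (WittVector p k)) *
    X a b ∈ (algebraMap (BKRing p k) (OE p k)).range}
  zero_mem' a b := by simp
  add_mem' {g g'} hg hg' a b := by
    rw [Polynomial.coe_add, map_add, add_mul]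
    exact add_mem (hg a b) (hg' a b)
  smul_mem' c g hg a b := by
    rw [smul_eq_mul, Polynomial.coe_mul, map_mul, mul_assoc]
    exact mul_mem ⟨_, rfl⟩ (hg a b)

/-- A matrix over `O_ℰ` which intertwines two `φ`-modules over `𝔖` of finite height has entries
in `𝔖`. -/
theorem mem_range_of_mul_eq_mul_phi {E : Polynomial (WittVector p k)} (hE : Prime E)
    (hmonic : E.Monic) (hE0 : E.coeff 0 ≠ 0) (hpE : (p : WittVector p k) ∣ E.coeff 0) {h h' : ℕ}
    (X : Matrix m n (OE p k)) {A A' : Matrix n n (BKRing p k)} {B B' : Matrix m m (BKRing p k)}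
    (hA : A * A' = ((E : PowerSeries (WittVector p k)) ^ h) • (1 : Matrix n n (BKRing p k)))
    (hB : B' * B = ((E : PowerSeries (WittVector p k)) ^ h') • (1 : Matrix m m (BKRing p k)))
    (hX : X * A.map (algebraMap (BKRing p k) (OE p k)) =
      B.map (algebraMap (BKRing p k) (OE p k)) * X.map (phiOE p k)) (a : m) (b : n) :
    X a b ∈ (algebraMap (BKRing p k) (OE p k)).range := by
  let ι := algebraMap (BKRing p k) (OE p k)
  let L : Submodule (BKRing p k) (OE p k) := LinearMap.range (Algebra.linearMap _ _)
  have hL (x : OE p k) : x ∈ L ↔ x ∈ (algebraMap (BKRing p k) (OE p k)).range := Iff.rfl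
  have hI : ι ((E : PowerSeries (WittVector p k)) ^ h) • X =
      B.map ι * X.map (phiOE p k) * A'.map ι := by
    rw [← hX, Matrix.mul_assoc, ← Matrix.map_mul, hA, map_smul_one, Matrix.mul_smul, Matrix.mul_one]
  have hII : ι ((E : PowerSeries (WittVector p k)) ^ h') • X.map (phiOE p k) =
      B'.map ι * X * A.map ι := by
    rw [Matrix.mul_assoc, hX, ← Matrix.mul_assoc, ← Matrix.map_mul, hB, map_smul_one,
      Matrix.smul_mul, Matrix.one_mul]
  -- some nonzero polynomial multiple of `X` has entries in `𝔖`
  have hne : denomIdeal X ≠ ⊥ := by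
    obtain ⟨g, hg0, hg⟩ := OE.exists_polynomial_mul_mem_range (fun c : m × n ↦ X c.1 c.2)
      (E.natDegree * h') fun N ↦ by
        obtain ⟨T, hT, hdeg, U, V, hUV⟩ := exists_iterate_eq E hmonic h' X A B' (fun a b ↦ by
          rw [← map_pow]
          exact congrFun₂ hII a b) N
        refine ⟨T, hT, hdeg, fun n i hx c ↦ ?_⟩
        rw [hUV]
        exact matrix_mul_mul_mem (OE.coeffSubmodule p k n i) U X V (fun a b ↦ hx (a, b)) _ _ i
          le_rfl
    exact fun h0 ↦ hg0 (by
      rw [← Ideal.mem_bot, ← h0]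
      exact fun a b ↦ hg (a, b))
  obtain ⟨P, hP, hP0, hdvd⟩ := exists_dvd_C_mul _ hne
  -- the ideal of denominators is stable under `g ↦ E ^ h φ(g)`
  have h1 : E ^ h * phiPoly p k P ∈ denomIdeal X := by
    intro a b
    have h2 : ι ((E ^ h * phiPoly p k P : Polynomial (WittVector p k)) :
        PowerSeries (WittVector p k)) * X a b =
        (B.map ι * (X.map fun x ↦ phiOE p k (ι (P : PowerSeries (WittVector p k)) * x)) *
          A'.map ι) a b := by
      have h3 := congrArg (ι (phiS p k P) * ·) (congrFun₂ hI a b)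
      rw [Polynomial.coe_mul, Polynomial.coe_pow, coe_phiPoly, mul_comm (_ ^ h), map_mul, mul_assoc]
      refine h3.trans ?_
      simp only [Matrix.mul_apply, Matrix.map_apply, Finset.mul_sum, Finset.sum_mul, map_mul, ι,
        phiOE_algebraMap]
      exact Finset.sum_congr rfl fun _ _ ↦ Finset.sum_congr rfl fun _ _ ↦ by ring
    rw [h2]
    refine matrix_mul_mul_mem L B _ A' (fun a b ↦ ?_) a b
    obtain ⟨s, hs⟩ := hP a b
    exact ⟨phiS p k s, (phiOE_algebraMap p k s).symm.trans (congrArg (phiOE p k) hs)⟩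
  obtain ⟨c, hc, hcP⟩ := hdvd _ h1
  -- `E ^ h' P` is a combination of images under `φ` of elements of the ideal of denominators
  obtain ⟨f, hf⟩ := exists_eq_sum_X_pow_mul_phiPoly (E ^ h' * P)
  have hfX (r : Fin p) : f r ∈ denomIdeal X := by
    intro a b
    rw [OE.mem_range_iff]
    refine OE.coeff_eq_zero_of_sum_X_pow_mul_phiOE
      (fun r ↦ ι (f r : PowerSeries (WittVector p k)) * X a b) ?_ r
    rw [← OE.mem_range_iff]
    have h2 := matrix_mul_mul_mem L B' (X.map (ι (P : PowerSeries (WittVector p k)) * ·)) A hP a b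
    have h3 : (B'.map ι * (X.map (ι (P : PowerSeries (WittVector p k)) * ·)) * A.map ι) a b =
        ι ((E ^ h' * P : Polynomial (WittVector p k)) : PowerSeries (WittVector p k)) *
          phiOE p k (X a b) := by
      have h4 := congrArg (ι (P : PowerSeries (WittVector p k)) * ·) (congrFun₂ hII a b)
      rw [Polynomial.coe_mul, Polynomial.coe_pow, mul_comm (_ ^ h'), map_mul, mul_assoc]
      refine Eq.trans ?_ h4.symm
      simp only [Matrix.mul_apply, Matrix.map_apply, Finset.mul_sum, Finset.sum_mul]
      exact Finset.sum_congr rfl fun _ _ ↦ Finset.sum_congr rfl fun _ _ ↦ by ring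
    have h5 : ((E ^ h' * P : Polynomial (WittVector p k)) : PowerSeries (WittVector p k)) =
        ∑ r : Fin p, PowerSeries.X ^ (r : ℕ) * phiS p k (f r : PowerSeries (WittVector p k)) := by
      have := congrArg (Polynomial.coeToPowerSeries.ringHom (R := WittVector p k)) hf
      rw [map_sum] at this
      simpa [coe_phiPoly] using this
    change (B'.map ι * (X.map (ι (P : PowerSeries (WittVector p k)) * ·)) * A.map ι) a b ∈ L at h2
    rw [h3, h5, map_sum, Finset.sum_mul, hL] at h2
    convert h2 using 2 with r
    rw [map_mul, map_mul, map_pow, phiOE_algebraMap, mul_assoc]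
  choose d hd hdP using fun r ↦ hdvd _ (hfX r)
  have h2 : phiPoly p k P ∣ Polynomial.C (∏ r, WittVector.frobenius (d r)) * (E ^ h' * P) := by
    rw [hf, Finset.mul_sum]
    refine Finset.dvd_sum fun r _ ↦ ?_
    have h3 := map_dvd (phiPoly p k) (hdP r)
    rw [map_mul, phiPoly_C] at h3
    rw [mul_left_comm]
    refine dvd_mul_of_dvd_right (h3.trans (mul_dvd_mul_right ?_ _)) _
    exact map_dvd _ (Finset.dvd_prod_of_mem _ (Finset.mem_univ r))
  have hdeg := natDegree_eq_zero_of_phiPoly hE hmonic hE0 hpE hP0 hc (Finset.prod_ne_zero_iff.mpr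
    fun r _ ↦ (map_ne_zero_iff _ frobenius_witt_injective).mpr (hd r)) hcP h2
  obtain ⟨w, rfl⟩ : ∃ w, P = Polynomial.C w := ⟨_, Polynomial.eq_C_of_natDegree_eq_zero hdeg⟩
  -- a constant denominator can be removed, since coefficients lie in a domain
  have h3 := hP a b
  rw [OE.mem_range_iff] at h3 ⊢
  intro i hi
  have h4 := h3 i hi
  rw [Polynomial.coe_C, OE.coeff_C_mul] at h4
  exact (mul_eq_zero.mp h4).resolve_left (Polynomial.C_ne_zero.mp hP0)

end

/-! ### From matrices to `φ`-modules -/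

section Minpoly

variable (p : ℕ) [hp : Fact p.Prime] {O : Type u} [CommRing O] [IsDomain O] [CharZero O]
  [Algebra ℤ_[p] O] [Module.Finite ℤ_[p] O] {π : O} [CharP (Residue π) p]
  [PerfectRing (Residue π) p] [Algebra (WittVector p (Residue π)) O]

/-- The minimal polynomial of a uniformizer over `W(κ)` is an irreducible Eisenstein polynomial. -/
lemma minpoly_isEisenstein (hπ : Prime π) (hmk : ∀ x : WittVector p (Residue π),
    Ideal.Quotient.mk (Ideal.span {π}) (algebraMap (WittVector p (Residue π)) O x) = x.coeff 0) :
    (minpoly (WittVector p (Residue π)) π).Monic ∧ Prime (minpoly (WittVector p (Residue π)) π) ∧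
      (minpoly (WittVector p (Residue π)) π).coeff 0 ≠ 0 ∧
      (p : WittVector p (Residue π)) ∣ (minpoly (WittVector p (Residue π)) π).coeff 0 := by
  have hfin := finite_witt p (π := π)
  have hdom := isDomain_residue hπ
  have hfin' := finite_residue p π hπ
  have hmax : (Ideal.span {π}).IsMaximal :=
    Ideal.Quotient.maximal_of_isField _ (Finite.isField_of_domain (Residue π))
  have hDVR : IsDiscreteValuationRing (WittVector p (Residue π)) := by
    let _ : Field (Residue π) := Ideal.Quotient.field (Ideal.span {π})
    exact WittVector.isDiscreteValuationRing (k := Residue π) (p := p)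
  have hinj : Function.Injective (algebraMap (WittVector p (Residue π)) O) := by
    rw [injective_iff_map_eq_zero]
    intro a ha
    refine witt_eq_zero_of_forall_pow_dvd p fun n ↦ ?_
    by_contra hn
    obtain ⟨m, b, hb, rfl⟩ := WittVector.exists_eq_pow_p_mul a (fun h0 ↦ hn (h0 ▸ dvd_zero _))
    rw [map_mul, map_pow, map_natCast] at ha
    have hb0 := (mul_eq_zero.mp ha).resolve_left
      (pow_ne_zero _ (Nat.cast_ne_zero.mpr hp.out.ne_zero))
    apply hb
    rw [← hmk, hb0, map_zero]
  have htf : Module.IsTorsionFree (WittVector p (Residue π)) O :=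
    Module.isTorsionFree_iff_algebraMap_injective.mpr hinj
  have hint : IsIntegral (WittVector p (Residue π)) π := Algebra.IsIntegral.isIntegral π
  have hprime := minpoly.prime_of_isIntegrallyClosed hint
  have hmonic := minpoly.monic hint
  refine ⟨hmonic, hprime, fun h0 ↦ ?_, ?_⟩
  · have h1 := Polynomial.prime_X.irreducible.associated_of_dvd hprime.irreducible
      (Polynomial.X_dvd_iff.mpr h0)
    have h2 := Polynomial.eq_of_monic_of_associated Polynomial.monic_X hmonic h1
    have h3 := minpoly.aeval (WittVector p (Residue π)) π
    rw [← h2, Polynomial.aeval_X] at h3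
    exact hπ.ne_zero h3
  · obtain ⟨n, hn⟩ := minpoly_mod_p p hπ hmk
    rw [Polynomial.C_dvd_iff_dvd_coeff] at hn
    have h1 := hn 0
    rcases Nat.eq_zero_or_pos n with rfl | hn0
    · exfalso
      have h2 := hn (minpoly (WittVector p (Residue π)) π).natDegree
      rw [Polynomial.coeff_sub, hmonic.coeff_natDegree, pow_zero, Polynomial.coeff_one,
        if_neg (minpoly.natDegree_pos hint).ne', sub_zero] at h2
      exact prime_natCast_witt.not_dvd_one h2
    · rwa [Polynomial.coeff_sub, Polynomial.coeff_X_pow, if_neg hn0.ne, sub_zero] at h1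

end Minpoly

lemma mul_eq_smul_one_comm {S m : Type*} [CommRing S] [IsDomain S] [Fintype m] [DecidableEq m]
    {B B' : Matrix m m S} {c : S} (hc : c ≠ 0) (h : B * B' = c • (1 : Matrix m m S)) :
    B' * B = c • (1 : Matrix m m S) := by
  have h1 : B.det ≠ 0 := by
    intro h0
    have h2 := congrArg Matrix.det h
    rw [Matrix.det_mul, h0, zero_mul, Matrix.det_smul, Matrix.det_one, mul_one] at h2
    exact pow_ne_zero _ hc h2.symm
  have h3 : B.det • (B' * B) = B.det • (c • (1 : Matrix m m S)) := by
    calc B.det • (B' * B) = B.adjugate * B * (B' * B) := by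
          rw [Matrix.adjugate_mul, Matrix.smul_mul, Matrix.one_mul]
      _ = B.adjugate * (B * B') * B := by simp only [Matrix.mul_assoc]
      _ = B.det • (c • (1 : Matrix m m S)) := by
          rw [h, Matrix.mul_smul, Matrix.mul_one, Matrix.smul_mul, Matrix.adjugate_mul, smul_comm]
  ext i j
  exact mul_left_cancel₀ h1 (congrFun₂ h3 i j)

section BaseChange

variable {Z : Type} [CommRing Z] {A B : Type u} [CommRing A] [Algebra Z A] [CommRing B]
  [Algebra Z B] [Algebra A B] [IsScalarTower Z A B] {R : Type u} [CommRing R] [Algebra Z R]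
  {φ : A →ₐ[Z] A} (ψ : B →ₐ[Z] B) (hψ : ∀ a, ψ (algebraMap A B a) = algebraMap A B (φ a))

namespace PhiModule

lemma toBaseChange_injective (hψ : ∀ a, ψ (algebraMap A B a) = algebraMap A B (φ a))
    (hAB : Function.Injective (algebraMap A B)) (M : PhiModule φ R)
    [Module.Free A M.carrier] : Function.Injective (toBaseChange (B := B) M) := by
  have h1 : Function.Injective (fun m : M.carrier ↦ (1 : B) ⊗ₜ[A] m) := by
    have h2 := Module.Flat.rTensor_preserves_injective_linearMap (M := M.carrier)
      (Algebra.linearMap A B) hAB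
    intro x y hxy
    have h3 : LinearMap.rTensor M.carrier (Algebra.linearMap A B) ((1 : A) ⊗ₜ x) =
        LinearMap.rTensor M.carrier (Algebra.linearMap A B) ((1 : A) ⊗ₜ y) := by
      simpa using hxy
    exact (TensorProduct.lid A M.carrier).symm.injective (h2 h3)
  have h4 (m : M.carrier) : (M.baseChangeEquiv ψ hψ).symm (1 ⊗ₜ m) = toBaseChange (B := B) M m := by
    rw [baseChangeEquiv_symm_tmul]
    exact one_smul B (toBaseChange (B := B) M m)
  intro x y hxy
  rw [← h4, ← h4] at hxy
  exact h1 ((M.baseChangeEquiv ψ hψ).symm.injective hxy)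

/-- A basis of `M` over `A` as a basis of the scalar extension over `B`. -/
def baseChangeBasis (M : PhiModule φ R) {ι : Type*} (b : Module.Basis ι A M.carrier) :
    Module.Basis ι B (M.baseChange ψ hψ).carrier :=
  (b.baseChange B).map (M.baseChangeEquiv ψ hψ).symm

lemma baseChangeBasis_apply (M : PhiModule φ R) {ι : Type*} (b : Module.Basis ι A M.carrier)
    (i : ι) :
    M.baseChangeBasis ψ hψ b i = toBaseChange (B := B) M (b i) := by
  rw [baseChangeBasis, Module.Basis.map_apply, Module.Basis.baseChange_apply,
    baseChangeEquiv_symm_tmul]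
  exact one_smul B (toBaseChange (B := B) M (b i))

lemma toBaseChange_sum_smul (M : PhiModule φ R) {ι : Type*} [Fintype ι]
    (b : Module.Basis ι A M.carrier) (c : ι → A) :
    toBaseChange (B := B) M (∑ i, c i • b i) =
      ∑ i, algebraMap A B (c i) • M.baseChangeBasis ψ hψ b i := by
  rw [map_sum]
  refine Finset.sum_congr rfl fun i _ ↦ ?_
  rw [toBaseChange_smul, baseChangeBasis_apply]
  rfl

lemma frob_smul (M : PhiModule φ R) (a : A) (m : M.carrier) :
    M.frob (a • m) = φ a • M.frob m :=
  M.frobA.map_smulₛₗ a m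

/-- The matrix of the Frobenius with respect to a basis over `A`. -/
def frobMatrix (M : PhiModule φ R) {ι : Type*} (b : Module.Basis ι A M.carrier) : Matrix ι ι A :=
  Matrix.of fun j i ↦ b.repr (M.frob (b i)) j

lemma frob_basis (M : PhiModule φ R) {ι : Type*} [Fintype ι] (b : Module.Basis ι A M.carrier)
    (i : ι) : M.frob (b i) = ∑ j, M.frobMatrix b j i • b j :=
  (b.sum_repr _).symm

lemma frob_baseChangeBasis (M : PhiModule φ R) {ι : Type*} [Fintype ι]
    (b : Module.Basis ι A M.carrier) (i : ι) :
    (M.baseChange ψ hψ).frob (M.baseChangeBasis ψ hψ b i) =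
      ∑ j, algebraMap A B (M.frobMatrix b j i) • M.baseChangeBasis ψ hψ b j := by
  rw [← toBaseChange_sum_smul, ← frob_basis, baseChangeBasis_apply]
  refine (frobBaseChange_tmul ψ hψ M.frob 1 (b i)).trans ?_
  rw [map_one]
  rfl

lemma exists_eq_sum_smul_frob (M : PhiModule φ R) {ι : Type*} [Fintype ι]
    (b : Module.Basis ι A M.carrier) {x : M.carrier} (hx : x ∈ M.lin.range) :
    ∃ c : ι → A, x = ∑ i, c i • M.frob (b i) := by
  obtain ⟨y, rfl⟩ := hx
  induction y with
  | zero => exact ⟨0, by simp⟩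
  | tmul a m =>
    refine ⟨fun i ↦ FrobTwist.untwist (φ : A →+* A) a * φ (b.repr m i), ?_⟩
    have h : M.frob m = ∑ i, φ (b.repr m i) • M.frob (b i) := by
      conv_lhs => rw [← b.sum_repr m, map_sum]
      exact Finset.sum_congr rfl fun i _ ↦ M.frob_smul _ _
    change FrobTwist.untwist (φ : A →+* A) a • M.frob m = _
    rw [h, Finset.smul_sum]
    exact Finset.sum_congr rfl fun i _ ↦ (mul_smul _ _ _).symm
  | add y z hy hz =>
    obtain ⟨c, hc⟩ := hy
    obtain ⟨d, hd⟩ := hz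
    exact ⟨c + d, by simp [hc, hd, add_smul, Finset.sum_add_distrib]⟩

/-- If `E ^ h` kills the cokernel of the linearized Frobenius, the matrix of the Frobenius divides
`E ^ h`. -/
lemma exists_frobMatrix_mul_eq (M : PhiModule φ R) {ι : Type*} [Fintype ι] [DecidableEq ι]
    (b : Module.Basis ι A M.carrier) {a : A} (ha : ∀ m : M.carrier, a • m ∈ M.lin.range) :
    ∃ A' : Matrix ι ι A, M.frobMatrix b * A' = a • (1 : Matrix ι ι A) := by
  choose c hc using fun i ↦ M.exists_eq_sum_smul_frob b (ha (b i))
  refine ⟨Matrix.of fun l i ↦ c i l, ?_⟩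
  ext j i
  have h := congrArg (fun x ↦ b.repr x j) (hc i)
  simp only [map_smul, map_sum, Finsupp.smul_apply, Finsupp.coe_finsetSum, Finset.sum_apply,
    Module.Basis.repr_self, smul_eq_mul, Finsupp.single_apply] at h
  rw [Matrix.mul_apply, Matrix.smul_apply, Matrix.one_apply, smul_eq_mul]
  simp only [eq_comm (a := j)]
  rw [h]
  exact Finset.sum_congr rfl fun l _ ↦ mul_comm _ _

/-- The matrix of a morphism between scalar extensions intertwines the matrices of the Frobenius. -/
lemma toMatrix_mul_frobMatrix {M N : PhiModule φ R} {m n : Type*} [Fintype m] [Fintype n]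
    (b : Module.Basis n A M.carrier) (c : Module.Basis m A N.carrier)
    (f : M.baseChange ψ hψ ⟶ N.baseChange ψ hψ) :
    (Matrix.of fun j i ↦ (N.baseChangeBasis ψ hψ c).repr (f.toLin (M.baseChangeBasis ψ hψ b i)) j) *
        (M.frobMatrix b).map (algebraMap A B) =
      (N.frobMatrix c).map (algebraMap A B) *
        (Matrix.of fun j i ↦
          (N.baseChangeBasis ψ hψ c).repr (f.toLin (M.baseChangeBasis ψ hψ b i)) j).map ψ := by
  set b' := M.baseChangeBasis ψ hψ b
  set c' := N.baseChangeBasis ψ hψ c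
  let g : (M.baseChange ψ hψ).carrier →ₗ[B] (N.baseChange ψ hψ).carrier :=
    f.toLin.restrictScalars B
  ext j i
  have h1 : c'.repr (g ((M.baseChange ψ hψ).frob (b' i))) j =
      ∑ l, c'.repr (g (b' l)) j * algebraMap A B (M.frobMatrix b l i) := by
    rw [frob_baseChangeBasis]
    simp only [map_sum, map_smul, Finsupp.coe_finsetSum, Finset.sum_apply, Finsupp.smul_apply,
      smul_eq_mul]
    exact Finset.sum_congr rfl fun l _ ↦ mul_comm _ _
  have h2 : c'.repr ((N.baseChange ψ hψ).frob (g (b' i))) j =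
      ∑ l, algebraMap A B (N.frobMatrix c j l) * ψ (c'.repr (g (b' i)) l) := by
    conv_lhs => rw [← c'.sum_repr (g (b' i)), map_sum]
    simp only [frob_smul, c', frob_baseChangeBasis, Finset.smul_sum, map_sum, map_smul,
      Finsupp.coe_finsetSum, Finset.sum_apply, Finsupp.smul_apply, smul_eq_mul,
      Module.Basis.repr_self]
    refine Finset.sum_congr rfl fun l _ ↦ ?_
    rw [Finset.sum_eq_single j, Finsupp.single_eq_same]
    · ring
    · intro x _ hx
      rw [Finsupp.single_eq_of_ne hx.symm, mul_zero, mul_zero]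
    · simp
  rw [Matrix.mul_apply, Matrix.mul_apply]
  exact h1.symm.trans ((congrArg (fun x ↦ c'.repr x j) (f.comm (b' i))).trans h2)

/-- A morphism between scalar extensions which maps `M` to `N` is induced by a morphism `M ⟶ N`. -/
lemma exists_map_eq (hAB : Function.Injective (algebraMap A B)) {M N : PhiModule φ R}
    [Module.Free A N.carrier] (f : M.baseChange ψ hψ ⟶ N.baseChange ψ hψ)
    (hf : ∀ m, f.toLin (toBaseChange (B := B) M m) ∈ Set.range (toBaseChange (B := B) N)) :
    ∃ g : M ⟶ N, (baseChangeFunctor ψ hψ).map g = f := by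
  let F : (B ⊗[Z] R) ⊗[A ⊗[Z] R] M.carrier →ₗ[B ⊗[Z] R] (B ⊗[Z] R) ⊗[A ⊗[Z] R] N.carrier := f.toLin
  have hinj := toBaseChange_injective ψ hψ hAB N
  let G := (F.restrictScalars (A ⊗[Z] R)) ∘ₗ toBaseChange (B := B) M
  choose g hg using hf
  have hg' (m) : toBaseChange (B := B) N (g m) = G m := hg m
  let g' : M.carrier →ₗ[A ⊗[Z] R] N.carrier :=
    { toFun := g
      map_add' := fun x y ↦ hinj (by rw [map_add, hg', hg', hg', map_add])
      map_smul' := fun a x ↦ hinj (by rw [map_smul, hg', hg', map_smul]; rfl) }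
  have hfrob (P : PhiModule φ R) (x : P.carrier) : toBaseChange (B := B) P (P.frob x) =
      (P.baseChange ψ hψ).frob (toBaseChange (B := B) P x) := by
    refine Eq.symm ((frobBaseChange_tmul ψ hψ P.frob 1 x).trans ?_)
    rw [map_one]
    rfl
  refine ⟨⟨g', fun m ↦ hinj ?_⟩, hom_ext ?_⟩
  · have h1 : toBaseChange (B := B) N (g (M.frob m)) =
        f.toLin (toBaseChange (B := B) M (M.frob m)) :=
      hg _
    refine h1.trans ?_
    rw [hfrob M m, hfrob N]
    refine (f.comm _).trans ?_
    exact congrArg (N.baseChange ψ hψ).frob (hg m).symm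
  -- both sides are linear over `B ⊗ R` and agree on `1 ⊗ m`
  · suffices h : g'.baseChange (B ⊗[Z] R) = F from h
    ext m
    exact hg m

end PhiModule

end BaseChange

section Main

variable (p : ℕ) [hp : Fact p.Prime] {K : Type u} [Field K] [Algebra ℚ_[p] K]
  [FiniteDimensional ℚ_[p] K] [Algebra ℤ_[p] K] [IsScalarTower ℤ_[p] ℚ_[p] K]
  (π : RingOfIntegers p K) [hπ : Fact (Prime π)] {R : Type u} [CommRing R] [Algebra ℤ_[p] R]

/-- A morphism between the étale `φ`-modules attached to `φ`-modules of finite height maps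
the `φ`-modules of finite height to each other. -/
lemma toLin_toBaseChange_mem_range {M N : PhiModule (phiS p (Residue π)) R}
    (hM : PhiModule.IsFiniteHeight (eisenstein p π) M)
    (hN : PhiModule.IsFiniteHeight (eisenstein p π) N)
    (f : M.baseChange (phiOE p (Residue π)) (phiOE_algebraMap p (Residue π)) ⟶
      N.baseChange (phiOE p (Residue π)) (phiOE_algebraMap p (Residue π))) (x : M.carrier) :
    f.toLin (PhiModule.toBaseChange (B := OE p (Residue π)) M x) ∈
      Set.range (PhiModule.toBaseChange (B := OE p (Residue π)) N) := by
  obtain ⟨_, _, h, -, hMh⟩ := hM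
  obtain ⟨_, _, h', -, hNh⟩ := hN
  have hdom := isDomain_residue hπ.out
  obtain ⟨hmonic, hprime, hE0, hpE⟩ := minpoly_isEisenstein p hπ.out (mk_algebraMap_witt p π)
  have hE : eisenstein p π ≠ 0 := fun h0 ↦ hprime.ne_zero (Polynomial.coe_eq_zero_iff.mp h0)
  classical
  let b := Module.Free.chooseBasis (BKRing p (Residue π)) M.carrier
  let c := Module.Free.chooseBasis (BKRing p (Residue π)) N.carrier
  obtain ⟨A', hA'⟩ := M.exists_frobMatrix_mul_eq b hMh
  obtain ⟨B', hB'⟩ := N.exists_frobMatrix_mul_eq c hNh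
  have hX := mem_range_of_mul_eq_mul_phi hprime hmonic hE0 hpE _ hA'
    (mul_eq_smul_one_comm (pow_ne_zero _ hE) hB')
    (PhiModule.toMatrix_mul_frobMatrix (phiOE p (Residue π)) (phiOE_algebraMap p (Residue π)) b c f)
  choose X hX using hX
  have hb (i) : f.toLin (PhiModule.toBaseChange (B := OE p (Residue π)) M (b i)) =
      PhiModule.toBaseChange (B := OE p (Residue π)) N (∑ j, X j i • c j) := by
    rw [PhiModule.toBaseChange_sum_smul (phiOE p (Residue π)) (phiOE_algebraMap p (Residue π)),
      ← PhiModule.baseChangeBasis_apply (phiOE p (Residue π)) (phiOE_algebraMap p (Residue π))]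
    simp only [hX, Matrix.of_apply]
    exact (Module.Basis.sum_repr _ _).symm
  let g : (M.baseChange (phiOE p (Residue π)) (phiOE_algebraMap p (Residue π))).carrier
      →ₗ[OE p (Residue π)] (N.baseChange (phiOE p (Residue π))
        (phiOE_algebraMap p (Residue π))).carrier := f.toLin.restrictScalars _
  refine ⟨∑ i, b.repr x i • ∑ j, X j i • c j, ?_⟩
  conv_rhs => rw [← b.sum_repr x]
  rw [PhiModule.toBaseChange_sum_smul (phiOE p (Residue π)) (phiOE_algebraMap p (Residue π)),
    map_sum]
  refine Eq.trans (Finset.sum_congr rfl fun i _ ↦ ?_) (map_sum g _ _).symm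
  rw [PhiModule.toBaseChange_smul, ← hb, ← PhiModule.baseChangeBasis_apply
    (phiOE p (Residue π)) (phiOE_algebraMap p (Residue π))]
  exact (map_smul g _ _).symm

end Main

end

end BreuilKisin

theorem mainTheorem6 (p : ℕ) [Fact p.Prime]
    (K : Type u) [Field K] [Algebra ℚ_[p] K] [FiniteDimensional ℚ_[p] K]
    [Algebra ℤ_[p] K] [IsScalarTower ℤ_[p] ℚ_[p] K]
    (π : BreuilKisin.RingOfIntegers p K) [Fact (Prime π)]
    (R : Type u) [CommRing R] [Algebra ℤ_[p] R] [Module.Finite ℤ_[p] R] [Module.Flat ℤ_[p] R] :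
    (BreuilKisin.scalarExtension p π R).Full ∧ (BreuilKisin.scalarExtension p π R).Faithful := by
  constructor
  · refine ⟨fun {M N} f ↦ ?_⟩
    have : Module.Free _ N.obj.carrier := N.property.2.1
    obtain ⟨g, hg⟩ := BreuilKisin.PhiModule.exists_map_eq (M := M.obj) (N := N.obj) _ _
      BreuilKisin.OE.algebraMap_injective f.hom
      (BreuilKisin.toLin_toBaseChange_mem_range p π M.property N.property f.hom)
    exact ⟨ObjectProperty.homMk g, ObjectProperty.hom_ext _ hg⟩
  · refine ⟨fun {M N} f g hfg ↦ ?_⟩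
    have : Module.Free _ N.obj.carrier := N.property.2.1
    refine ObjectProperty.hom_ext _ (BreuilKisin.PhiModule.hom_ext (LinearMap.ext fun x ↦ ?_))
    apply BreuilKisin.PhiModule.toBaseChange_injective
      (BreuilKisin.phiOE p (BreuilKisin.Residue π)) (BreuilKisin.phiOE_algebraMap p _)
      BreuilKisin.OE.algebraMap_injective N.obj
    have h := congrArg (fun F ↦ BreuilKisin.PhiModule.Hom.toLin F.hom
      (BreuilKisin.PhiModule.toBaseChange (B := BreuilKisin.OE p (BreuilKisin.Residue π)) M.obj x))
      hfg
    exact h
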